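/- Let $H$ be a complex Hilbert space (not necessarily separable) and let $k$ be an integer with $0<k<\dim H$ (if $H$ is infinite-dimensional, any integer $k>0$). The ortho-Grassmann graph $\Gamma^{\perp}_k(H)$ is the simple graph whose vertices are the $k$-dimensional subspaces of $H$, and in which two vertices $X,Y$ are joined by an edge if and only if they are adjacent, i.e. $\dim(X\cap Y)=k-1$, and compatible, i.e. there is an orthonormal basis of $H$ such that $X$ and $Y$ are both spanned by subsets of this basis. A transformation $f$ of the vertex set is induced by an operator $U$ on $H$ if $f(X)=U(X)$ for every $k$-dimensional subspace $X$. An invertible linear operator $U$ on $H$ is unitary if $\langle U(x),U(y)\rangle=\langle x,y\rangle$ for all $x,y\in H$; an invertible conjugate-linear operator $U$ on $H$ is anti-unitary if $\langle U(x),U(y)\rangle=\overline{\langle x,y\rangle}$ for all $x,y\in H$. (1) If $\dim H\neq 2k$ (in particular, if $H$ is infinite-dimensional), then every automorphism of $\Gamma^{\perp}_k(H)$ is induced by a unitary or anti-unitary operator on $H$. (2) If $\dim H=2k\ge 6$, then every automorphism of $\Gamma^{\perp}_k(H)$ is induced by a unitary or anti-unitary operator on $H$, or is the composition of such an automorphism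 and the orthocomplementary map $X\mapsto X^{\perp}$. -/

import Mathlib

namespace OrthoGrassmann

variable {H : Type*} [NormedAddCommGroup H] [InnerProductSpace ℂ H]

/-- The Grassmannian of `k`-dimensional subspaces of `H`. -/
def Grassmannian (H : Type*) [NormedAddCommGroup H] [InnerProductSpace ℂ H] (k : ℕ) : Type _ :=
  {X : Submodule ℂ H // FiniteDimensional ℂ X ∧ Module.finrank ℂ X = k}

/-- `X` and `Y` are compatible: there is an orthonormal basis `B` of the Hilbert space `H` (a
complete orthonormal set, of any cardinality) such that the closed subspaces `X` and `Y` are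
spanned by subsets of `B`. -/
def Compatible (X Y : Submodule ℂ H) : Prop :=
  ∃ (B : Set H) (b : HilbertBasis B ℂ H), ⇑b = ((↑) : B → H) ∧
    (∃ S ⊆ B, X = (Submodule.span ℂ S).topologicalClosure) ∧
    (∃ T ⊆ B, Y = (Submodule.span ℂ T).topologicalClosure)

/-- Two `k`-dimensional subspaces are adjacent if their intersection is `(k-1)`-dimensional. -/
def Adjacent {k : ℕ} (X Y : Grassmannian H k) : Prop :=
  Module.finrank ℂ (X.1 ⊓ Y.1 : Submodule ℂ H) + 1 = k

/-- The ortho-Grassmann graph: the vertices are the `k`-dimensional subspaces of `H`, and two of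
them are joined by an edge if they are adjacent and compatible. -/
def orthoGrassmannGraph (H : Type*) [NormedAddCommGroup H] [InnerProductSpace ℂ H] (k : ℕ) :
    SimpleGraph (Grassmannian H k) where
  Adj X Y := Adjacent X Y ∧ Compatible X.1 Y.1
  symm := ⟨by
    rintro X Y ⟨h, B, b, hb, hX, hY⟩
    exact ⟨by rwa [Adjacent, inf_comm], B, b, hb, hY, hX⟩⟩
  loopless := ⟨by
    rintro ⟨X, hX, hk⟩ ⟨h, -⟩
    have h' : Module.finrank ℂ (X ⊓ X : Submodule ℂ H) + 1 = k := h
    rw [inf_idem] at h'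
    omega⟩

/-- An invertible linear operator is unitary if it preserves the inner product. -/
def IsUnitary (U : H ≃ₗ[ℂ] H) : Prop :=
  ∀ x y : H, inner ℂ (U x) (U y) = inner ℂ x y

/-- An invertible conjugate-linear operator is anti-unitary if it conjugates the inner product. -/
def IsAntiunitary (U : H ≃ₛₗ[starRingEnd ℂ] H) : Prop :=
  ∀ x y : H, inner ℂ (U x) (U y) = starRingEnd ℂ (inner ℂ x y)

/-- A transformation `f` of the Grassmannian is induced by a unitary or anti-unitary operator `U`
of `H`: `f X = U(X)` for every `k`-dimensional subspace `X`. -/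
def IsInducedByUnitaryOrAntiunitary {k : ℕ} (f : Grassmannian H k → Grassmannian H k) : Prop :=
  (∃ U : H ≃ₗ[ℂ] H, IsUnitary U ∧
    ∀ X, (f X).1 = X.1.map (U : H →ₗ[ℂ] H)) ∨
  (∃ U : H ≃ₛₗ[starRingEnd ℂ] H, IsAntiunitary U ∧
    ∀ X, (f X).1 = X.1.map (U : H →ₛₗ[starRingEnd ℂ] H))

end OrthoGrassmann

/-!
The heart of the matter is the case `k = 1` (Uhlhorn's theorem, `isInduced_of_lines`), to which the
general case descends one dimension at a time.

In coordinates, an edge joins `Z + ⟨x⟩` and `Z + ⟨y⟩` with `x`, `y` orthogonal to each other and to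
`Z` (`adj_iff`). A triangle of the graph is either a star, with a common `(k - 1)`-dimensional
subspace, or is contained in a `(k + 1)`-dimensional subspace, never both (`IsStar`,
`le_sup_of_not_isStar`, `IsStar.not_le_sup`). An automorphism `f` respecting this distinction
induces an automorphism `g` of the graph of `(k - 1)`-dimensional subspaces, with
`Z ≤ X → g Z ≤ f X` (`exists_descent`): for `p ⟂ q` in `Zᗮ` the subspace `f (Z + ⟨p⟩) ∩ f (Z + ⟨q⟩)`
does not depend on the choice of `p` and `q`, since any two choices are linked by overlapping
orthogonal triples. An operator inducing `g` also induces `f`, because every vector of `X` lies in a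
hyperplane of `X`.

If `dim H > 2k`, star triangles are exactly those contained in a clique of size `k + 2`, so `f`
respects them (`isStar_map_iff`), and the descent reaches `k = 1` (`isInduced_of_two_mul_lt`). If
`dim H < 2k`, conjugation by the orthocomplementary map exchanges `k` for `dim H - k`
(`isInduced_of_conj`).

If `dim H = 2k ≥ 6`, both types of triangle look alike, and the orthocomplementary map interchanges
them. But whether `f` preserves the type of a triangle depends only on an edge of it
(`isStar_map_iff_of_edge`). As the links of vertices and the graph itself are connected, `f`
preserves the type of all triangles or reverses the type of all (`isStar_map_iff_of_triangle`); in
the second case `X ↦ (f X)ᗮ` preserves them. The descent then lands below the middle dimension.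

For lines, orthogonality determines collinearity, since a plane is its own double orthocomplement.
The fundamental theorem of projective geometry is proved here for orthogonality-preserving
correspondences (`OrthoCorrespondence.exists_semilinear`): in the affine chart `e₀ + e₀ᗮ` the map
becomes additive and homogeneous along a ring homomorphism `σ`. Orthogonality of `x + a y` and
`x - (conj a)⁻¹ y` makes `σ` commute with conjugation, so `σ` fixes `ℝ` and is the identity or the
conjugation; a rescaling then makes the operator unitary or anti-unitary.
-/

namespace OrthoGrassmann

open Module

/-! ### Orthogonal extensions and the edges of the graph -/

section

variable {H : Type*} [NormedAddCommGroup H] [InnerProductSpace ℂ H]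

/-- Gram–Schmidt step: subtract from a vector of `X` outside `V` its projection to `V`. -/
theorem exists_orthogonal_of_not_le {V X : Submodule ℂ H} [FiniteDimensional ℂ V] (h : ¬ X ≤ V) :
    ∃ x, x ≠ 0 ∧ x ∈ Vᗮ ∧ x ∈ V ⊔ X := by
  obtain ⟨v, hv, hvV⟩ := SetLike.not_le_iff_exists.1 h
  refine ⟨v - V.starProjection v, ?_, ?_, ?_⟩
  · intro h0
    rw [sub_eq_zero] at h0
    exact hvV (h0 ▸ Submodule.starProjection_apply_mem V v)
  · exact Submodule.sub_starProjection_mem_orthogonal v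
  · exact Submodule.sub_mem _ (Submodule.mem_sup_right hv)
      (Submodule.mem_sup_left (Submodule.starProjection_apply_mem V v))

theorem disjoint_span_of_mem_orthogonal {B : Submodule ℂ H} {x : H} (hB : x ∈ Bᗮ) :
    Disjoint B (ℂ ∙ x) :=
  B.orthogonal_disjoint.mono_right ((Submodule.span_singleton_le_iff_mem _ _).2 hB)

theorem finrank_sup_span {B : Submodule ℂ H} [FiniteDimensional ℂ B] {x : H} (hx : x ≠ 0)
    (hB : x ∈ Bᗮ) : finrank ℂ (B ⊔ ℂ ∙ x : Submodule ℂ H) = finrank ℂ B + 1 := by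
  have h := Submodule.finrank_sup_add_finrank_inf_eq B (ℂ ∙ x)
  rwa [(disjoint_span_of_mem_orthogonal hB).eq_bot, finrank_bot, finrank_span_singleton hx,
    add_zero] at h

theorem exists_eq_sup_span {B X : Submodule ℂ H} [FiniteDimensional ℂ B] [FiniteDimensional ℂ X]
    (hBX : B ≤ X) (h : finrank ℂ B + 1 = finrank ℂ X) :
    ∃ x, x ≠ 0 ∧ x ∈ Bᗮ ∧ X = B ⊔ ℂ ∙ x := by
  have hle : ¬ X ≤ B := fun h' => by
    have := Submodule.finrank_mono h'
    omega
  obtain ⟨x, hx, hxB, hxX⟩ := exists_orthogonal_of_not_le hle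
  rw [sup_eq_right.2 hBX] at hxX
  refine ⟨x, hx, hxB, (Submodule.eq_of_le_of_finrank_le (sup_le hBX ?_) ?_).symm⟩
  · exact (Submodule.span_singleton_le_iff_mem _ _).2 hxX
  · rw [finrank_sup_span hx hxB, h]

theorem exists_mem_orthogonal {V : Submodule ℂ H} [FiniteDimensional ℂ V]
    (h : (finrank ℂ V : Cardinal) < Module.rank ℂ H) : ∃ x, x ≠ 0 ∧ x ∈ Vᗮ := by
  have hle : ¬ (⊤ : Submodule ℂ H) ≤ V := fun h' => by
    have : V = ⊤ := top_le_iff.1 h'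
    subst this
    rw [finrank_eq_rank, rank_top] at h
    exact h.false
  obtain ⟨x, hx, hxV, -⟩ := exists_orthogonal_of_not_le hle
  exact ⟨x, hx, hxV⟩

theorem mem_sup_span_orthogonal {B : Submodule ℂ H} {x v : H} :
    v ∈ (B ⊔ ℂ ∙ x)ᗮ ↔ v ∈ Bᗮ ∧ inner ℂ x v = 0 := by
  rw [← Submodule.inf_orthogonal, Submodule.mem_inf,
    Submodule.mem_orthogonal_singleton_iff_inner_right]

theorem sup_span_inf_sup_span {B : Submodule ℂ H} {x y : H} (hx : x ∈ Bᗮ) (hy : y ∈ Bᗮ)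
    (hxy : inner ℂ x y = 0) : (B ⊔ ℂ ∙ x) ⊓ (B ⊔ ℂ ∙ y) = B := by
  refine le_antisymm ?_ (le_inf le_sup_left le_sup_left)
  rintro v ⟨h1, h2⟩
  obtain ⟨b, hb, u, hu, rfl⟩ := Submodule.mem_sup.1 h1
  obtain ⟨a, rfl⟩ := Submodule.mem_span_singleton.1 hu
  have hy' : y ∈ (B ⊔ ℂ ∙ x)ᗮ := mem_sup_span_orthogonal.2 ⟨hy, hxy⟩
  have h3 : a • x ∈ B ⊔ ℂ ∙ y := by
    have := Submodule.sub_mem _ h2 (Submodule.mem_sup_left (T := ℂ ∙ y) hb)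
    simpa using this
  have h4 : a • x ∈ (B ⊔ ℂ ∙ y)ᗮ := by
    refine Submodule.smul_mem _ _ (mem_sup_span_orthogonal.2 ⟨hx, ?_⟩)
    rw [inner_eq_zero_symm, hxy]
  have h5 : a • x = 0 := by
    have := (Submodule.orthogonal_disjoint (B ⊔ ℂ ∙ y)).le_bot ⟨h3, h4⟩
    simpa using this
  rw [h5, add_zero]
  exact hb

/-- An orthogonal pair of extensions of a common subspace `B`: the coordinate form of adjacency
together with compatibility. The vectors `x` and `y` are only nonzero, not normalized. -/
def OrthoAdj (X Y : Submodule ℂ H) : Prop :=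
  ∃ (B : Submodule ℂ H) (x y : H), x ≠ 0 ∧ y ≠ 0 ∧ x ∈ Bᗮ ∧ y ∈ Bᗮ ∧ inner ℂ x y = 0 ∧
    X = B ⊔ ℂ ∙ x ∧ Y = B ⊔ ℂ ∙ y

theorem mem_orthogonal_span {S : Set H} {x : H} (h : ∀ s ∈ S, inner ℂ s x = 0) :
    x ∈ (Submodule.span ℂ S)ᗮ := by
  intro u hu
  induction hu using Submodule.span_induction with
  | mem s hs => exact h s hs
  | zero => exact inner_zero_left _
  | add a b _ _ ha hb => rw [inner_add_left, ha, hb, add_zero]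
  | smul c a _ ha => rw [inner_smul_left, ha, mul_zero]

/-- Compatibility as commuting projections: what `X` has orthogonal to `X ∩ Y` is orthogonal to `Y`.
A basis vector of `Y` that is not in the spanning set of `X` is orthogonal to all of `X`. -/
theorem mem_orthogonal_of_compatible {X Y : Submodule ℂ H} (h : Compatible X Y) {x : H}
    (hx : x ∈ X) (hxY : x ∈ (X ⊓ Y)ᗮ) : x ∈ Yᗮ := by
  classical
  obtain ⟨B, b, hb, ⟨S, hS, rfl⟩, ⟨T, hT, rfl⟩⟩ := h
  have hon := b.orthonormal
  rw [hb, orthonormal_subtype_iff_ite] at hon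
  rw [Submodule.orthogonal_closure]
  refine mem_orthogonal_span fun t ht => ?_
  by_cases htS : t ∈ S
  · refine hxY t ⟨?_, ?_⟩
    · exact Submodule.le_topologicalClosure _ (Submodule.subset_span htS)
    · exact Submodule.le_topologicalClosure _ (Submodule.subset_span ht)
  · have : t ∈ (Submodule.span ℂ S).topologicalClosureᗮ := by
      rw [Submodule.orthogonal_closure]
      refine mem_orthogonal_span fun s hs => ?_
      rw [hon s (hS hs) t (hT ht), if_neg]
      rintro rfl
      exact htS hs
    rw [inner_eq_zero_symm]
    exact this x hx

theorem compatible_of_orthonormal [CompleteSpace H] {B : Submodule ℂ H} [FiniteDimensional ℂ B]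
    {x y : H} (hx : ‖x‖ = 1) (hy : ‖y‖ = 1) (hxB : x ∈ Bᗮ) (hyB : y ∈ Bᗮ)
    (hxy : inner ℂ x y = 0) : Compatible (B ⊔ ℂ ∙ x) (B ⊔ ℂ ∙ y) := by
  let b := stdOrthonormalBasis ℂ B
  let v : Fin (finrank ℂ B) ⊕ Bool → H := Sum.elim (fun i => (b i : H)) fun c => cond c x y
  have hb : Submodule.span ℂ (Set.range fun i => (b i : H)) = B := by
    have h1 := congrArg (Submodule.map B.subtype) b.toBasis.span_eq
    rw [Submodule.map_span, ← Set.range_comp, Submodule.map_subtype_top] at h1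
    convert h1 using 3
    ext i
    simp
  have hv : Orthonormal ℂ v := by
    refine ⟨?_, ?_⟩
    · rintro (i | (_ | _))
      · exact b.orthonormal.1 i
      · exact hy
      · exact hx
    · rintro (i | (_ | _)) (j | (_ | _)) hij
      · exact b.orthonormal.2 fun h => hij (congrArg _ h)
      · exact hyB _ (b i).2
      · exact hxB _ (b i).2
      · exact inner_eq_zero_symm.1 (hyB _ (b j).2)
      · exact absurd rfl hij
      · exact inner_eq_zero_symm.1 hxy
      · exact inner_eq_zero_symm.1 (hxB _ (b j).2)
      · exact hxy
      · exact absurd rfl hij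
  obtain ⟨w, c, hw, hc⟩ := hv.toSubtypeRange.exists_hilbertBasis_extension
  have key : ∀ c : Bool, B ⊔ ℂ ∙ (cond c x y) =
      (Submodule.span ℂ (Set.range (fun i => (b i : H)) ∪ {cond c x y})).topologicalClosure := by
    intro c
    rw [Submodule.span_union, hb]
    exact (Submodule.closed_of_finiteDimensional _).submodule_topologicalClosure_eq.symm
  refine ⟨w, c, hc, ⟨_, ?_, key true⟩, ⟨_, ?_, key false⟩⟩
  · rintro _ (⟨i, rfl⟩ | rfl)
    · exact hw ⟨Sum.inl i, rfl⟩
    · exact hw ⟨Sum.inr true, rfl⟩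
  · rintro _ (⟨i, rfl⟩ | rfl)
    · exact hw ⟨Sum.inl i, rfl⟩
    · exact hw ⟨Sum.inr false, rfl⟩

theorem OrthoAdj.compatible [CompleteSpace H] {X Y : Submodule ℂ H} [FiniteDimensional ℂ X]
    (h : OrthoAdj X Y) : Compatible X Y := by
  obtain ⟨B, x, y, hx, hy, hxB, hyB, hxy, rfl, rfl⟩ := h
  have : FiniteDimensional ℂ B :=
    Submodule.finiteDimensional_of_le (le_sup_left : B ≤ B ⊔ ℂ ∙ x)
  have hx' : ((‖x‖ : ℂ)⁻¹) ≠ 0 := by simpa using hx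
  have hy' : ((‖y‖ : ℂ)⁻¹) ≠ 0 := by simpa using hy
  rw [← Submodule.span_singleton_smul_eq (IsUnit.mk0 _ hx') x,
    ← Submodule.span_singleton_smul_eq (IsUnit.mk0 _ hy') y]
  refine compatible_of_orthonormal (norm_smul_inv_norm hx) (norm_smul_inv_norm hy)
    (Submodule.smul_mem _ _ hxB) (Submodule.smul_mem _ _ hyB) ?_
  rw [inner_smul_left, inner_smul_right, hxy, mul_zero, mul_zero]

instance {k : ℕ} (X : Grassmannian H k) : FiniteDimensional ℂ X.1 := X.2.1

@[ext]
theorem Grassmannian.ext {k : ℕ} {X Y : Grassmannian H k} (h : X.1 = Y.1) : X = Y := Subtype.ext h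

theorem Grassmannian.eq_of_le {k : ℕ} {X Y : Grassmannian H k} (h : X.1 ≤ Y.1) : X = Y :=
  Grassmannian.ext (Submodule.eq_of_le_of_finrank_eq h (X.2.2.trans Y.2.2.symm))

theorem adj_iff [CompleteSpace H] {k : ℕ} {X Y : Grassmannian H k} :
    (orthoGrassmannGraph H k).Adj X Y ↔ OrthoAdj X.1 Y.1 := by
  constructor
  · rintro ⟨h1, h2⟩
    have h1' : finrank ℂ (X.1 ⊓ Y.1 : Submodule ℂ H) + 1 = k := h1
    obtain ⟨x, hx, hxB, hX⟩ := exists_eq_sup_span (inf_le_left : X.1 ⊓ Y.1 ≤ X.1)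
      (h1'.trans X.2.2.symm)
    obtain ⟨y, hy, hyB, hY⟩ := exists_eq_sup_span (inf_le_right : X.1 ⊓ Y.1 ≤ Y.1)
      (h1'.trans Y.2.2.symm)
    refine ⟨X.1 ⊓ Y.1, x, y, hx, hy, hxB, hyB, ?_, hX, hY⟩
    have hxX : x ∈ X.1 := by
      rw [hX]
      exact Submodule.mem_sup_right (Submodule.mem_span_singleton_self x)
    have hyY : y ∈ Y.1 := by
      rw [hY]
      exact Submodule.mem_sup_right (Submodule.mem_span_singleton_self y)
    exact inner_eq_zero_symm.1 (mem_orthogonal_of_compatible h2 hxX hxB y hyY)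
  · intro h
    refine ⟨?_, h.compatible⟩
    obtain ⟨B, x, y, hx, hy, hxB, hyB, hxy, hX, hY⟩ := h
    have : FiniteDimensional ℂ B :=
      Submodule.finiteDimensional_of_le (le_sup_left.trans hX.ge : B ≤ X.1)
    have h1 := X.2.2
    rw [hX, finrank_sup_span hx hxB] at h1
    rw [Adjacent, hX, hY, sup_span_inf_sup_span hxB hyB hxy, h1]

end

/-! ### Triangles of the graph: stars and their complements -/

section

variable {H : Type*} [NormedAddCommGroup H] [InnerProductSpace ℂ H]

theorem exists_grassmannian_eq_sup_span {k : ℕ} {Z : Submodule ℂ H} [FiniteDimensional ℂ Z] {x : H}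
    (hZ : finrank ℂ Z + 1 = k) (hx : x ≠ 0) (hxZ : x ∈ Zᗮ) :
    ∃ X : Grassmannian H k, X.1 = Z ⊔ ℂ ∙ x :=
  ⟨⟨Z ⊔ ℂ ∙ x, inferInstance, by rw [finrank_sup_span hx hxZ, hZ]⟩, rfl⟩

theorem exists_orthogonal_family (r : ℕ) (V : Submodule ℂ H) [FiniteDimensional ℂ V]
    (h : ((finrank ℂ V + r : ℕ) : Cardinal) ≤ Module.rank ℂ H) :
    ∃ v : Fin r → H, (∀ i, v i ≠ 0 ∧ v i ∈ Vᗮ) ∧ ∀ i j, i ≠ j → inner ℂ (v i) (v j) = 0 := by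
  induction r generalizing V with
  | zero => exact ⟨Fin.elim0, fun i => i.elim0, fun i => i.elim0⟩
  | succ r ih =>
    obtain ⟨u, hu, huV⟩ := exists_mem_orthogonal (V := V)
      (lt_of_lt_of_le (by exact_mod_cast (by omega : finrank ℂ V < finrank ℂ V + (r + 1))) h)
    obtain ⟨v, hv, hvv⟩ := ih (V ⊔ ℂ ∙ u) (by
      rw [finrank_sup_span hu huV]
      convert h using 2
      ring)
    refine ⟨Fin.cons u v, ?_, ?_⟩
    · refine Fin.cases ⟨hu, huV⟩ fun i => ?_
      exact ⟨(hv i).1, (mem_sup_span_orthogonal.1 (hv i).2).1⟩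
    · refine Fin.cases (Fin.cases (fun h => absurd rfl h) fun j _ => ?_)
        fun i => Fin.cases (fun _ => ?_) fun j hij => ?_
      · exact (mem_sup_span_orthogonal.1 (hv j).2).2
      · exact inner_eq_zero_symm.1 (mem_sup_span_orthogonal.1 (hv i).2).2
      · exact hvv i j fun h => hij (congrArg _ h)

variable {k : ℕ} {X Y X₁ X₂ X₃ X₄ : Grassmannian H k}

theorem finrank_inf_of_adj (h : (orthoGrassmannGraph H k).Adj X Y) :
    finrank ℂ (X.1 ⊓ Y.1 : Submodule ℂ H) + 1 = k := h.1

theorem finrank_sup_of_adj (h : (orthoGrassmannGraph H k).Adj X Y) :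
    finrank ℂ (X.1 ⊔ Y.1 : Submodule ℂ H) = k + 1 := by
  have h1 := Submodule.finrank_sup_add_finrank_inf_eq X.1 Y.1
  have h2 := finrank_inf_of_adj h
  rw [X.2.2, Y.2.2] at h1
  omega

/-- A vertex `X₃` completes the edge `X₁X₂` to a star when it contains the intersection
`X₁ ∩ X₂`. -/
def IsStar (X₁ X₂ X₃ : Grassmannian H k) : Prop := X₁.1 ⊓ X₂.1 ≤ X₃.1

theorem IsStar.inf_eq (h12 : (orthoGrassmannGraph H k).Adj X₁ X₂)
    (h13 : (orthoGrassmannGraph H k).Adj X₁ X₃) (h : IsStar X₁ X₂ X₃) :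
    X₁.1 ⊓ X₂.1 = X₁.1 ⊓ X₃.1 :=
  Submodule.eq_of_le_of_finrank_eq (le_inf inf_le_left h) <| by
    have := finrank_inf_of_adj h12
    have := finrank_inf_of_adj h13
    omega

theorem isStar_swap_left : IsStar X₁ X₂ X₃ ↔ IsStar X₂ X₁ X₃ := by
  rw [IsStar, IsStar, inf_comm]

theorem isStar_swap_right (h12 : (orthoGrassmannGraph H k).Adj X₁ X₂)
    (h13 : (orthoGrassmannGraph H k).Adj X₁ X₃) : IsStar X₁ X₂ X₃ ↔ IsStar X₁ X₃ X₂ := by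
  constructor
  · intro h
    exact (h.inf_eq h12 h13).ge.trans inf_le_right
  · intro h
    exact (h.inf_eq h13 h12).ge.trans inf_le_right

/-- If `X₃` does not contain `X₁ ∩ X₂`, it is the sum of its intersections with `X₁` and `X₂`. -/
theorem le_sup_of_not_isStar (h12 : (orthoGrassmannGraph H k).Adj X₁ X₂)
    (h13 : (orthoGrassmannGraph H k).Adj X₁ X₃) (h23 : (orthoGrassmannGraph H k).Adj X₂ X₃)
    (h : ¬ IsStar X₁ X₂ X₃) : X₃.1 ≤ X₁.1 ⊔ X₂.1 := by
  have hlt : X₂.1 ⊓ X₃.1 < X₁.1 ⊓ X₃.1 ⊔ X₂.1 ⊓ X₃.1 := by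
    refine lt_of_le_of_ne le_sup_right fun he => h ?_
    rw [isStar_swap_right h12 h13]
    exact (le_sup_left.trans he.ge).trans inf_le_left
  have h1 := Submodule.finrank_lt_finrank_of_lt hlt
  have h2 := finrank_inf_of_adj h23
  have h3 : X₁.1 ⊓ X₃.1 ⊔ X₂.1 ⊓ X₃.1 = X₃.1 := by
    refine Submodule.eq_of_le_of_finrank_le (sup_le inf_le_right inf_le_right) ?_
    rw [X₃.2.2]
    omega
  rw [← h3]
  exact sup_le_sup inf_le_left inf_le_left

theorem finrank_sup_sup_le (h12 : (orthoGrassmannGraph H k).Adj X₁ X₂)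
    (h13 : (orthoGrassmannGraph H k).Adj X₁ X₃) :
    finrank ℂ (X₁.1 ⊔ X₂.1 ⊔ X₃.1 : Submodule ℂ H) ≤ k + 2 := by
  have h1 := Submodule.finrank_sup_add_finrank_inf_eq (X₁.1 ⊔ X₂.1) X₃.1
  have h2 := finrank_sup_of_adj h12
  have h3 := finrank_inf_of_adj h13
  have h4 : finrank ℂ (X₁.1 ⊓ X₃.1 : Submodule ℂ H) ≤
      finrank ℂ ((X₁.1 ⊔ X₂.1) ⊓ X₃.1 : Submodule ℂ H) :=
    Submodule.finrank_mono (inf_le_inf_right _ le_sup_left)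
  have h5 := X₃.2.2
  omega

variable [CompleteSpace H]

/-- In coordinates over a common hyperplane `Z`, being joined by an edge is orthogonality. -/
theorem adj_iff_inner_eq_zero {Z : Submodule ℂ H} {x y : H} (hx : x ≠ 0) (hy : y ≠ 0)
    (hxZ : x ∈ Zᗮ) (hyZ : y ∈ Zᗮ) (hX : X.1 = Z ⊔ ℂ ∙ x) (hY : Y.1 = Z ⊔ ℂ ∙ y) :
    (orthoGrassmannGraph H k).Adj X Y ↔ inner ℂ x y = 0 := by
  refine ⟨fun h => ?_, fun h => adj_iff.2 ⟨Z, x, y, hx, hy, hxZ, hyZ, h, hX, hY⟩⟩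
  have : FiniteDimensional ℂ Z :=
    Submodule.finiteDimensional_of_le (le_sup_left.trans hX.ge : Z ≤ X.1)
  have h1 := X.2.2
  rw [hX, finrank_sup_span hx hxZ] at h1
  have hZ : Z = X.1 ⊓ Y.1 := by
    refine Submodule.eq_of_le_of_finrank_eq ?_ ?_
    · rw [hX, hY]
      exact le_inf le_sup_left le_sup_left
    · have := finrank_inf_of_adj h
      omega
  rw [hZ] at hxZ
  have hxX : x ∈ X.1 := by
    rw [hX]
    exact Submodule.mem_sup_right (Submodule.mem_span_singleton_self x)
  have hyY : y ∈ Y.1 := by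
    rw [hY]
    exact Submodule.mem_sup_right (Submodule.mem_span_singleton_self y)
  exact inner_eq_zero_symm.1 (mem_orthogonal_of_compatible h.2 hxX hxZ y hyY)

/-- The dual form of compatibility: what `X + Y` has orthogonal to `X` lies in `Y`. -/
theorem mem_of_adj_of_mem_orthogonal (h : (orthoGrassmannGraph H k).Adj X Y) {w : H}
    (hw : w ∈ X.1 ⊔ Y.1) (hwX : w ∈ X.1ᗮ) : w ∈ Y.1 := by
  obtain ⟨B, x, y, hx, hy, hxB, hyB, hxy, hX, hY⟩ := adj_iff.1 h
  have hyX : y ∈ X.1ᗮ := by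
    rw [hX]
    exact mem_sup_span_orthogonal.2 ⟨hyB, hxy⟩
  have hsup : X.1 ⊔ Y.1 = X.1 ⊔ ℂ ∙ y := by
    rw [hX, hY, sup_sup_sup_comm, sup_idem, sup_assoc]
  rw [hsup] at hw
  obtain ⟨u, hu, v, hv, rfl⟩ := Submodule.mem_sup.1 hw
  have hv' : v ∈ X.1ᗮ := (Submodule.span_singleton_le_iff_mem _ _).2 hyX hv
  have hu' : u ∈ X.1ᗮ := by simpa using Submodule.sub_mem _ hwX hv'
  have : u = 0 := by simpa using X.1.orthogonal_disjoint.le_bot ⟨hu, hu'⟩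
  rw [this, zero_add, hY]
  exact Submodule.mem_sup_right hv

theorem IsStar.not_le_sup (h12 : (orthoGrassmannGraph H k).Adj X₁ X₂)
    (h13 : (orthoGrassmannGraph H k).Adj X₁ X₃) (h23 : (orthoGrassmannGraph H k).Adj X₂ X₃)
    (h : IsStar X₁ X₂ X₃) : ¬ X₃.1 ≤ X₁.1 ⊔ X₂.1 := by
  intro hle
  obtain ⟨B, x, y, hx, hy, hxB, hyB, hxy, hX, hY⟩ := adj_iff.1 h12
  have hB : X₁.1 ⊓ X₂.1 = B := by rw [hX, hY, sup_span_inf_sup_span hxB hyB hxy]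
  rw [IsStar, hB] at h
  have hfB : FiniteDimensional ℂ B := Submodule.finiteDimensional_of_le h
  have hf := finrank_inf_of_adj h12
  rw [hB] at hf
  obtain ⟨z, hz, hzB, hZ⟩ := exists_eq_sup_span h (hf.trans X₃.2.2.symm)
  have hxz := (adj_iff_inner_eq_zero hx hz hxB hzB hX hZ).1 h13
  have hyz := (adj_iff_inner_eq_zero hy hz hyB hzB hY hZ).1 h23
  have hz1 : z ∈ X₁.1 ⊔ X₂.1 := hle (by
    rw [hZ]
    exact Submodule.mem_sup_right (Submodule.mem_span_singleton_self z))
  have hz2 : z ∈ (X₁.1 ⊔ X₂.1)ᗮ := by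
    rw [← Submodule.inf_orthogonal, hX, hY]
    exact ⟨mem_sup_span_orthogonal.2 ⟨hzB, hxz⟩, mem_sup_span_orthogonal.2 ⟨hzB, hyz⟩⟩
  exact hz (by simpa using (X₁.1 ⊔ X₂.1).orthogonal_disjoint.le_bot ⟨hz1, hz2⟩)

/-- A clique of four vertices is a star or lies in a common `(k + 1)`-dimensional subspace as a
whole: its triangles cannot be of different types. -/
theorem IsStar.of_clique (h12 : (orthoGrassmannGraph H k).Adj X₁ X₂)
    (h13 : (orthoGrassmannGraph H k).Adj X₁ X₃) (h23 : (orthoGrassmannGraph H k).Adj X₂ X₃)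
    (h14 : (orthoGrassmannGraph H k).Adj X₁ X₄) (h24 : (orthoGrassmannGraph H k).Adj X₂ X₄)
    (h34 : (orthoGrassmannGraph H k).Adj X₃ X₄) (h : IsStar X₁ X₂ X₃) : IsStar X₁ X₂ X₄ := by
  by_contra h4
  have h5 := le_sup_of_not_isStar h12 h14 h24 h4
  refine h.not_le_sup h12 h13 h23 ((le_sup_of_not_isStar h14 h13 h34.symm fun h6 => h4 ?_).trans
    (sup_le le_sup_left h5))
  rw [← isStar_swap_right h13 h14, IsStar, ← h.inf_eq h12 h13] at h6
  exact h6

end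

/-! ### Recognizing stars by the size of cliques -/

section

variable {H : Type*} [NormedAddCommGroup H] [InnerProductSpace ℂ H]
variable {k : ℕ} {X Y X₁ X₂ X₃ X₄ : Grassmannian H k}

theorem sup_eq_of_adj {W : Submodule ℂ H} [FiniteDimensional ℂ W]
    (h : (orthoGrassmannGraph H k).Adj X Y) (hX : X.1 ≤ W) (hY : Y.1 ≤ W)
    (hW : finrank ℂ W = k + 1) : X.1 ⊔ Y.1 = W :=
  Submodule.eq_of_le_of_finrank_eq (sup_le hX hY) ((finrank_sup_of_adj h).trans hW.symm)

variable [CompleteSpace H]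

/-- Below the middle dimension there is room for `k - 1` further orthogonal directions, which extend
a star triangle to a clique of size `k + 2`. -/
theorem IsStar.exists_extension (hk : ((2 * k + 1 : ℕ) : Cardinal) ≤ Module.rank ℂ H)
    (h12 : (orthoGrassmannGraph H k).Adj X₁ X₂) (h13 : (orthoGrassmannGraph H k).Adj X₁ X₃)
    (h : IsStar X₁ X₂ X₃) :
    ∃ Y : Fin (k - 1) → Grassmannian H k,
      (∀ i, (orthoGrassmannGraph H k).Adj (Y i) X₁ ∧ (orthoGrassmannGraph H k).Adj (Y i) X₂ ∧
        (orthoGrassmannGraph H k).Adj (Y i) X₃) ∧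
      ∀ i j, i ≠ j → (orthoGrassmannGraph H k).Adj (Y i) (Y j) := by
  have hZ := finrank_inf_of_adj h12
  obtain ⟨v, hv, hvv⟩ := exists_orthogonal_family (k - 1) (X₁.1 ⊔ X₂.1 ⊔ X₃.1) <| by
    refine le_trans ?_ hk
    have := finrank_sup_sup_le h12 h13
    exact_mod_cast (by omega)
  have hZV : X₁.1 ⊓ X₂.1 ≤ X₁.1 ⊔ X₂.1 ⊔ X₃.1 := inf_le_left.trans (le_sup_left.trans le_sup_left)
  have hvZ : ∀ i, v i ∈ (X₁.1 ⊓ X₂.1)ᗮ := fun i => Submodule.orthogonal_le hZV (hv i).2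
  choose Y hY using fun i => exists_grassmannian_eq_sup_span hZ (hv i).1 (hvZ i)
  have key : ∀ (X : Grassmannian H k) (i), X₁.1 ⊓ X₂.1 ≤ X.1 → X.1 ≤ X₁.1 ⊔ X₂.1 ⊔ X₃.1 →
      (orthoGrassmannGraph H k).Adj (Y i) X := by
    intro X i h1 h2
    obtain ⟨x, hx, hxZ, hX⟩ := exists_eq_sup_span h1 (hZ.trans X.2.2.symm)
    refine (adj_iff_inner_eq_zero (hv i).1 hx (hvZ i) hxZ (hY i) hX).2 ?_
    refine inner_eq_zero_symm.1 ((hv i).2 x (h2 ?_))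
    rw [hX]
    exact Submodule.mem_sup_right (Submodule.mem_span_singleton_self x)
  refine ⟨Y, fun i => ⟨key _ i inf_le_left (le_sup_left.trans le_sup_left),
    key _ i inf_le_right (le_sup_right.trans le_sup_left), key _ i h le_sup_right⟩,
    fun i j hij => ?_⟩
  exact (adj_iff_inner_eq_zero (hv i).1 (hv j).1 (hvZ i) (hvZ j) (hY i) (hY j)).2 (hvv i j hij)

/-- Inside a `(k + 1)`-dimensional `W`, adjacent hyperplanes have orthogonal normals. A clique of
size `k + 2` would give `k - 1` orthogonal normals in the `(k - 2)`-dimensional intersection of the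
triangle. -/
theorem isStar_of_exists_extension (h12 : (orthoGrassmannGraph H k).Adj X₁ X₂)
    (h13 : (orthoGrassmannGraph H k).Adj X₁ X₃) (h23 : (orthoGrassmannGraph H k).Adj X₂ X₃)
    (Y : Fin (k - 1) → Grassmannian H k)
    (hY : ∀ i, (orthoGrassmannGraph H k).Adj (Y i) X₁ ∧ (orthoGrassmannGraph H k).Adj (Y i) X₂ ∧
        (orthoGrassmannGraph H k).Adj (Y i) X₃)
    (hYY : ∀ i j, i ≠ j → (orthoGrassmannGraph H k).Adj (Y i) (Y j)) : IsStar X₁ X₂ X₃ := by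
  by_contra hstar
  have hW := finrank_sup_of_adj h12
  have h3W := le_sup_of_not_isStar h12 h13 h23 hstar
  have hYW : ∀ i, (Y i).1 ≤ X₁.1 ⊔ X₂.1 := fun i =>
    le_sup_of_not_isStar h12 (hY i).1.symm (hY i).2.1.symm fun h =>
      hstar (h.of_clique h12 (hY i).1.symm (hY i).2.1.symm h13 h23 (hY i).2.2)
  choose w hw0 hwY hw using fun i =>
    exists_eq_sup_span (hYW i) ((congrArg (· + 1) (Y i).2.2).trans hW.symm)
  have hwW : ∀ i, w i ∈ X₁.1 ⊔ X₂.1 := fun i => by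
    rw [hw i]
    exact Submodule.mem_sup_right (Submodule.mem_span_singleton_self _)
  have key : ∀ i (X : Grassmannian H k), (orthoGrassmannGraph H k).Adj (Y i) X →
      X.1 ≤ X₁.1 ⊔ X₂.1 → w i ∈ X.1 := fun i X h hX => by
    refine mem_of_adj_of_mem_orthogonal h ?_ (hwY i)
    rw [sup_eq_of_adj h (hYW i) hX hW]
    exact hwW i
  have hli : LinearIndependent ℂ w := by
    refine linearIndependent_of_ne_zero_of_inner_eq_zero hw0 fun i j hij => ?_
    exact hwY j _ (key i (Y j) (hYY i j hij) (hYW j))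
  have hlt : finrank ℂ (X₁.1 ⊓ X₂.1 ⊓ X₃.1 : Submodule ℂ H) <
      finrank ℂ (X₁.1 ⊓ X₂.1 : Submodule ℂ H) := by
    refine Submodule.finrank_lt_finrank_of_lt (lt_of_le_of_ne inf_le_left fun he => hstar ?_)
    exact he.ge.trans inf_le_right
  have hle : Submodule.span ℂ (Set.range w) ≤ X₁.1 ⊓ X₂.1 ⊓ X₃.1 := by
    rw [Submodule.span_le]
    rintro _ ⟨i, rfl⟩
    exact ⟨⟨key i _ (hY i).1 le_sup_left, key i _ (hY i).2.1 le_sup_right⟩,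
      key i _ (hY i).2.2 h3W⟩
  have h1 := Submodule.finrank_mono hle
  rw [finrank_span_eq_card hli, Fintype.card_fin] at h1
  have := finrank_inf_of_adj h12
  omega

/-- Below the middle dimension, a star triangle is recognized by the size of the cliques that
contain it. -/
theorem isStar_map_iff (hk : ((2 * k + 1 : ℕ) : Cardinal) ≤ Module.rank ℂ H)
    (f : orthoGrassmannGraph H k ≃g orthoGrassmannGraph H k)
    (h12 : (orthoGrassmannGraph H k).Adj X₁ X₂) (h13 : (orthoGrassmannGraph H k).Adj X₁ X₃)
    (h23 : (orthoGrassmannGraph H k).Adj X₂ X₃) :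
    IsStar (f X₁) (f X₂) (f X₃) ↔ IsStar X₁ X₂ X₃ := by
  have key : ∀ (f : orthoGrassmannGraph H k ≃g orthoGrassmannGraph H k)
      {X₁ X₂ X₃ : Grassmannian H k}, (orthoGrassmannGraph H k).Adj X₁ X₂ →
      (orthoGrassmannGraph H k).Adj X₁ X₃ → (orthoGrassmannGraph H k).Adj X₂ X₃ →
      IsStar X₁ X₂ X₃ → IsStar (f X₁) (f X₂) (f X₃) := by
    intro f X₁ X₂ X₃ h12 h13 h23 h
    obtain ⟨Y, hY, hYY⟩ := h.exists_extension hk h12 h13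
    refine isStar_of_exists_extension (f.map_adj_iff.2 h12) (f.map_adj_iff.2 h13)
      (f.map_adj_iff.2 h23) (fun i => f (Y i)) (fun i => ?_) fun i j hij => ?_
    · simpa only [f.map_adj_iff] using hY i
    · exact f.map_adj_iff.2 (hYY i j hij)
  refine ⟨fun h => ?_, key f h12 h13 h23⟩
  simpa using key f.symm (f.map_adj_iff.2 h12) (f.map_adj_iff.2 h13) (f.map_adj_iff.2 h23) h

end

/-! ### Descent to subspaces of smaller dimension -/

section

variable {H : Type*} [NormedAddCommGroup H] [InnerProductSpace ℂ H]

theorem finrank_sup_span_le (V : Submodule ℂ H) [FiniteDimensional ℂ V] (x : H) :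
    finrank ℂ (V ⊔ ℂ ∙ x : Submodule ℂ H) ≤ finrank ℂ V + 1 :=
  (Submodule.finrank_add_le_finrank_add_finrank _ _).trans
    (Nat.add_le_add_left ((finrank_span_le_card {x}).trans (by simp)) _)

theorem exists_orthogonal_three {V : Submodule ℂ H} [FiniteDimensional ℂ V]
    (h : ((finrank ℂ V + 4 : ℕ) : Cardinal) ≤ Module.rank ℂ H) (x y z : H) :
    ∃ u, u ≠ 0 ∧ u ∈ Vᗮ ∧ inner ℂ x u = 0 ∧ inner ℂ y u = 0 ∧ inner ℂ z u = 0 := by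
  have h1 := finrank_sup_span_le V x
  have h2 := finrank_sup_span_le (V ⊔ ℂ ∙ x) y
  have h3 := finrank_sup_span_le (V ⊔ ℂ ∙ x ⊔ ℂ ∙ y) z
  obtain ⟨u, hu, huV⟩ := exists_mem_orthogonal (V := V ⊔ ℂ ∙ x ⊔ ℂ ∙ y ⊔ ℂ ∙ z)
    (lt_of_lt_of_le (by exact_mod_cast (by omega)) h)
  simp only [mem_sup_span_orthogonal] at huV
  exact ⟨u, hu, huV.1.1.1, huV.1.1.2, huV.1.2, huV.2⟩

variable {k : ℕ}

theorem inf_eq_of_adj_of_le {Z : Grassmannian H k} {X Y : Grassmannian H (k + 1)}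
    (h : (orthoGrassmannGraph H (k + 1)).Adj X Y) (hX : Z.1 ≤ X.1) (hY : Z.1 ≤ Y.1) :
    Z.1 = X.1 ⊓ Y.1 :=
  Submodule.eq_of_le_of_finrank_eq (le_inf hX hY) <| by
    have := finrank_inf_of_adj h
    have := Z.2.2
    omega

variable [CompleteSpace H]

/-- The images of the subspaces containing `Z` share a subspace of the dimension of `Z`. -/
theorem exists_le_map (hk : ((k + 4 : ℕ) : Cardinal) ≤ Module.rank ℂ H)
    (f : orthoGrassmannGraph H (k + 1) ≃g orthoGrassmannGraph H (k + 1))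
    (hf : ∀ {X₁ X₂ X₃}, (orthoGrassmannGraph H (k + 1)).Adj X₁ X₂ →
      (orthoGrassmannGraph H (k + 1)).Adj X₁ X₃ → (orthoGrassmannGraph H (k + 1)).Adj X₂ X₃ →
      IsStar X₁ X₂ X₃ → IsStar (f X₁) (f X₂) (f X₃)) (Z : Grassmannian H k) :
    ∃ Z' : Grassmannian H k, ∀ X : Grassmannian H (k + 1), Z.1 ≤ X.1 → Z'.1 ≤ (f X).1 := by
  have hZ : finrank ℂ Z.1 + 1 = k + 1 := congrArg (· + 1) Z.2.2
  have hk' : ((finrank ℂ Z.1 + 4 : ℕ) : Cardinal) ≤ Module.rank ℂ H := by rwa [Z.2.2]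
  have hE : ∀ {P Q R : Grassmannian H (k + 1)}, Z.1 ≤ P.1 → Z.1 ≤ Q.1 → Z.1 ≤ R.1 →
      (orthoGrassmannGraph H (k + 1)).Adj P Q → (orthoGrassmannGraph H (k + 1)).Adj P R →
      (orthoGrassmannGraph H (k + 1)).Adj Q R → (f P).1 ⊓ (f Q).1 ≤ (f R).1 := by
    intro P Q R hP hQ hR hPQ hPR hQR
    refine hf hPQ hPR hQR ?_
    rwa [IsStar, ← inf_eq_of_adj_of_le hPQ hP hQ]
  obtain ⟨p, hp, hpZ, -⟩ := exists_orthogonal_three hk' 0 0 0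
  obtain ⟨q, hq, hqZ, hpq, -⟩ := exists_orthogonal_three hk' p 0 0
  obtain ⟨P, hP⟩ := exists_grassmannian_eq_sup_span hZ hp hpZ
  obtain ⟨Q, hQ⟩ := exists_grassmannian_eq_sup_span hZ hq hqZ
  have hPQ : (orthoGrassmannGraph H (k + 1)).Adj P Q :=
    (adj_iff_inner_eq_zero hp hq hpZ hqZ hP hQ).2 hpq
  refine ⟨⟨(f P).1 ⊓ (f Q).1, inferInstance, ?_⟩, fun X hX => ?_⟩
  · simpa using finrank_inf_of_adj (f.map_adj_iff.2 hPQ)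
  obtain ⟨x, hx, hxZ, hxX⟩ := exists_eq_sup_span hX (hZ.trans X.2.2.symm)
  -- Two more directions link the pair `P`, `Q` to `X` through overlapping orthogonal triples.
  obtain ⟨r, hr, hrZ, hpr, hqr, hxr⟩ := exists_orthogonal_three hk' p q x
  obtain ⟨s, hs, hsZ, hps, hrs, hxs⟩ := exists_orthogonal_three hk' p r x
  obtain ⟨R, hR⟩ := exists_grassmannian_eq_sup_span hZ hr hrZ
  obtain ⟨S, hS⟩ := exists_grassmannian_eq_sup_span hZ hs hsZ
  have hPR := (adj_iff_inner_eq_zero hp hr hpZ hrZ hP hR).2 hpr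
  have hQR := (adj_iff_inner_eq_zero hq hr hqZ hrZ hQ hR).2 hqr
  have hPS := (adj_iff_inner_eq_zero hp hs hpZ hsZ hP hS).2 hps
  have hRS := (adj_iff_inner_eq_zero hr hs hrZ hsZ hR hS).2 hrs
  have hXR := (adj_iff_inner_eq_zero hx hr hxZ hrZ hxX hR).2 hxr
  have hXS := (adj_iff_inner_eq_zero hx hs hxZ hsZ hxX hS).2 hxs
  have hZP : Z.1 ≤ P.1 := le_sup_left.trans hP.ge
  have hZR : Z.1 ≤ R.1 := le_sup_left.trans hR.ge
  have hZS : Z.1 ≤ S.1 := le_sup_left.trans hS.ge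
  have h1 : (f P).1 ⊓ (f Q).1 ≤ (f R).1 := hE hZP (le_sup_left.trans hQ.ge) hZR hPQ hPR hQR
  have h2 : (f P).1 ⊓ (f R).1 ≤ (f S).1 := hE hZP hZR hZS hPR hPS hRS
  have h3 : (f R).1 ⊓ (f S).1 ≤ (f X).1 := hE hZR hZS hX hRS hXR.symm hXS.symm
  exact (le_inf h1 ((le_inf inf_le_left h1).trans h2)).trans h3

/-- An automorphism preserving stars induces an automorphism on subspaces of dimension one less. An
edge `A + ⟨z₁⟩`, `A + ⟨z₂⟩` extends by a new direction `u` to a triangle that is not a star, and the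
images of its two ends are read off from the image of that triangle. -/
theorem exists_descent (hk : ((k + 4 : ℕ) : Cardinal) ≤ Module.rank ℂ H)
    (f : orthoGrassmannGraph H (k + 1) ≃g orthoGrassmannGraph H (k + 1))
    (hf : ∀ {X₁ X₂ X₃}, (orthoGrassmannGraph H (k + 1)).Adj X₁ X₂ →
      (orthoGrassmannGraph H (k + 1)).Adj X₁ X₃ → (orthoGrassmannGraph H (k + 1)).Adj X₂ X₃ →
      (IsStar (f X₁) (f X₂) (f X₃) ↔ IsStar X₁ X₂ X₃)) :
    ∃ g : orthoGrassmannGraph H k ≃g orthoGrassmannGraph H k,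
      ∀ (Z : Grassmannian H k) (X : Grassmannian H (k + 1)), Z.1 ≤ X.1 → (g Z).1 ≤ (f X).1 := by
  have hf' : ∀ {X₁ X₂ X₃}, (orthoGrassmannGraph H (k + 1)).Adj X₁ X₂ →
      (orthoGrassmannGraph H (k + 1)).Adj X₁ X₃ → (orthoGrassmannGraph H (k + 1)).Adj X₂ X₃ →
      (IsStar (f.symm X₁) (f.symm X₂) (f.symm X₃) ↔ IsStar X₁ X₂ X₃) := by
    intro X₁ X₂ X₃ h12 h13 h23
    rw [← hf (f.symm.map_adj_iff.2 h12) (f.symm.map_adj_iff.2 h13) (f.symm.map_adj_iff.2 h23)]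
    simp
  choose g hg using exists_le_map hk f fun h12 h13 h23 => (hf h12 h13 h23).2
  choose g' hg' using exists_le_map hk f.symm fun h12 h13 h23 => (hf' h12 h13 h23).2
  have hbelow : ∀ Z Z' : Grassmannian H k,
      (∀ X : Grassmannian H (k + 1), Z.1 ≤ X.1 → Z'.1 ≤ X.1) → Z' = Z := by
    intro Z Z' h
    have hZ : finrank ℂ Z.1 + 1 = k + 1 := congrArg (· + 1) Z.2.2
    have hk' : ((finrank ℂ Z.1 + 4 : ℕ) : Cardinal) ≤ Module.rank ℂ H := by rwa [Z.2.2]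
    obtain ⟨p, hp, hpZ, -⟩ := exists_orthogonal_three hk' 0 0 0
    obtain ⟨q, hq, hqZ, hpq, -⟩ := exists_orthogonal_three hk' p 0 0
    obtain ⟨P, hP⟩ := exists_grassmannian_eq_sup_span hZ hp hpZ
    obtain ⟨Q, hQ⟩ := exists_grassmannian_eq_sup_span hZ hq hqZ
    refine Grassmannian.eq_of_le ?_
    rw [← sup_span_inf_sup_span hpZ hqZ hpq, ← hP, ← hQ]
    exact le_inf (h P (le_sup_left.trans hP.ge)) (h Q (le_sup_left.trans hQ.ge))
  have hinv : ∀ Z, g' (g Z) = Z := fun Z => hbelow _ _ fun X hX => by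
    simpa using hg' (g Z) (f X) (hg Z X hX)
  have hinv' : ∀ Z, g (g' Z) = Z := fun Z => hbelow _ _ fun X hX => by
    simpa using hg (g' Z) (f.symm X) (hg' Z X hX)
  have hadj : ∀ {f : orthoGrassmannGraph H (k + 1) ≃g orthoGrassmannGraph H (k + 1)}
      {g : Grassmannian H k → Grassmannian H k}, (∀ {X₁ X₂ X₃},
      (orthoGrassmannGraph H (k + 1)).Adj X₁ X₂ →
      (orthoGrassmannGraph H (k + 1)).Adj X₁ X₃ → (orthoGrassmannGraph H (k + 1)).Adj X₂ X₃ →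
      (IsStar (f X₁) (f X₂) (f X₃) ↔ IsStar X₁ X₂ X₃)) →
      (∀ (Z : Grassmannian H k) (X : Grassmannian H (k + 1)), Z.1 ≤ X.1 → (g Z).1 ≤ (f X).1) →
      ∀ {Z₁ Z₂ : Grassmannian H k}, (orthoGrassmannGraph H k).Adj Z₁ Z₂ →
        (orthoGrassmannGraph H k).Adj (g Z₁) (g Z₂) := by
    intro f g hf hg Z₁ Z₂ h
    obtain ⟨A, z₁, z₂, hz₁, hz₂, hz₁A, hz₂A, hz, hZ₁, hZ₂⟩ := adj_iff.1 h
    have hsup := finrank_sup_of_adj h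
    obtain ⟨u, hu, huX⟩ := exists_mem_orthogonal (V := Z₁.1 ⊔ Z₂.1)
      (lt_of_lt_of_le (by exact_mod_cast (by omega)) hk)
    rw [← Submodule.inf_orthogonal, hZ₁, hZ₂, Submodule.mem_inf, mem_sup_span_orthogonal,
      mem_sup_span_orthogonal] at huX
    obtain ⟨⟨huA, h1u⟩, -, h2u⟩ := huX
    have hu1 : u ∈ Z₁.1ᗮ := hZ₁ ▸ mem_sup_span_orthogonal.2 ⟨huA, h1u⟩
    have hu2 : u ∈ Z₂.1ᗮ := hZ₂ ▸ mem_sup_span_orthogonal.2 ⟨huA, h2u⟩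
    have hz21 : z₂ ∈ Z₁.1ᗮ := hZ₁ ▸ mem_sup_span_orthogonal.2 ⟨hz₂A, hz⟩
    have hz12 : z₁ ∈ Z₂.1ᗮ :=
      hZ₂ ▸ mem_sup_span_orthogonal.2 ⟨hz₁A, inner_eq_zero_symm.1 hz⟩
    -- The three `k + 1`-dimensional coordinate subspaces of `A ⊕ ⟨z₁, z₂, u⟩` containing `A`.
    let X : Grassmannian H (k + 1) := ⟨Z₁.1 ⊔ Z₂.1, inferInstance, hsup⟩
    have hX1 : X.1 = Z₁.1 ⊔ ℂ ∙ z₂ := by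
      change Z₁.1 ⊔ Z₂.1 = _
      rw [hZ₁, hZ₂, sup_sup_sup_comm, sup_idem, sup_assoc]
    have hX2 : X.1 = Z₂.1 ⊔ ℂ ∙ z₁ := by
      change Z₁.1 ⊔ Z₂.1 = _
      rw [hZ₁, hZ₂, sup_sup_sup_comm, sup_idem, sup_right_comm, sup_assoc]
    obtain ⟨X₁, hX₁⟩ := exists_grassmannian_eq_sup_span (congrArg (· + 1) Z₁.2.2) hu hu1
    obtain ⟨X₂, hX₂⟩ := exists_grassmannian_eq_sup_span (congrArg (· + 1) Z₂.2.2) hu hu2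
    have a1 : (orthoGrassmannGraph H (k + 1)).Adj X X₁ :=
      (adj_iff_inner_eq_zero hz₂ hu hz21 hu1 hX1 hX₁).2 h2u
    have a2 : (orthoGrassmannGraph H (k + 1)).Adj X X₂ :=
      (adj_iff_inner_eq_zero hz₁ hu hz12 hu2 hX2 hX₂).2 h1u
    have a12 : (orthoGrassmannGraph H (k + 1)).Adj X₁ X₂ := by
      refine adj_iff.2 ⟨A ⊔ ℂ ∙ u, z₁, z₂, hz₁, hz₂, mem_sup_span_orthogonal.2
        ⟨hz₁A, inner_eq_zero_symm.1 h1u⟩, mem_sup_span_orthogonal.2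
        ⟨hz₂A, inner_eq_zero_symm.1 h2u⟩, hz, ?_, ?_⟩
      · rw [hX₁, hZ₁, sup_right_comm]
      · rw [hX₂, hZ₂, sup_right_comm]
    have hZX₁ : Z₁.1 ≤ X₁.1 := le_sup_left.trans hX₁.ge
    have hZX₂ : Z₂.1 ≤ X₂.1 := le_sup_left.trans hX₂.ge
    have hZ1 : Z₁.1 ≤ X.1 := le_sup_left
    have hZ2 : Z₂.1 ≤ X.1 := le_sup_right
    have hns : ¬ IsStar X X₁ X₂ := by
      intro hs
      have h1 := inf_eq_of_adj_of_le a1 hZ1 hZX₁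
      have h2 := inf_eq_of_adj_of_le a2 hZ2 hZX₂
      refine h.ne (Grassmannian.ext ?_)
      rw [h1, h2]
      exact hs.inf_eq a1 a2
    rw [← hf a1 a2 a12] at hns
    rw [← f.map_adj_iff] at a1 a2 a12
    have hle := le_sup_of_not_isStar a1 a2 a12 hns
    have hsup1 := finrank_sup_of_adj a1
    have hsup2 := sup_eq_of_adj a2 le_sup_left hle hsup1
    have hsup12 := sup_eq_of_adj a12 le_sup_right hle hsup1
    obtain ⟨w₁, hw₁, hw₁Y, hw₁W⟩ := exists_eq_sup_span
      (le_sup_right : (f X₁).1 ≤ (f X).1 ⊔ (f X₁).1)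
      ((congrArg (· + 1) (f X₁).2.2).trans hsup1.symm)
    obtain ⟨w₂, hw₂, hw₂Y, hw₂W⟩ := exists_eq_sup_span hle
      ((congrArg (· + 1) (f X₂).2.2).trans hsup1.symm)
    have hm1 : w₁ ∈ (f X).1 ⊔ (f X₁).1 := by
      rw [hw₁W]
      exact Submodule.mem_sup_right (Submodule.mem_span_singleton_self _)
    have hm2 : w₂ ∈ (f X).1 ⊔ (f X₁).1 := by
      rw [hw₂W]
      exact Submodule.mem_sup_right (Submodule.mem_span_singleton_self _)
    have h1X : w₁ ∈ (f X).1 := mem_of_adj_of_mem_orthogonal a1.symm (by rwa [sup_comm]) hw₁Y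
    have h12 : w₁ ∈ (f X₂).1 := mem_of_adj_of_mem_orthogonal a12 (by rwa [hsup12]) hw₁Y
    have h2X : w₂ ∈ (f X).1 :=
      mem_of_adj_of_mem_orthogonal a2.symm (by rwa [sup_comm, hsup2]) hw₂Y
    have h21 : w₂ ∈ (f X₁).1 :=
      mem_of_adj_of_mem_orthogonal a12.symm (by rwa [sup_comm, hsup12]) hw₂Y
    have g1 := inf_eq_of_adj_of_le a1 (hg _ _ hZ1) (hg _ _ hZX₁)
    have g2 := inf_eq_of_adj_of_le a2 (hg _ _ hZ2) (hg _ _ hZX₂)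
    have hgle : (g Z₁).1 ⊔ (g Z₂).1 ≤ (f X).1 := sup_le (hg _ _ hZ1) (hg _ _ hZ2)
    have hgf : k ≤ finrank ℂ ((g Z₁).1 ⊓ (g Z₂).1 : Submodule ℂ H) + 1 := by
      have e1 := Submodule.finrank_sup_add_finrank_inf_eq (g Z₁).1 (g Z₂).1
      have e2 := Submodule.finrank_mono hgle
      have e3 := (g Z₁).2.2
      have e4 := (g Z₂).2.2
      have e5 := (f X).2.2
      omega
    have o1 : w₁ ∈ ((g Z₁).1 ⊓ (g Z₂).1)ᗮ :=
      Submodule.orthogonal_le (inf_le_left.trans (g1.le.trans inf_le_right)) hw₁Y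
    have o2 : w₂ ∈ ((g Z₁).1 ⊓ (g Z₂).1)ᗮ :=
      Submodule.orthogonal_le (inf_le_right.trans (g2.le.trans inf_le_right)) hw₂Y
    refine adj_iff.2 ⟨_, w₂, w₁, hw₂, hw₁, o2, o1, ?_, ?_, ?_⟩
    · exact hw₁Y w₂ h21
    · refine (Submodule.eq_of_le_of_finrank_le (sup_le inf_le_left ?_) ?_).symm
      · rw [Submodule.span_singleton_le_iff_mem, g1]
        exact ⟨h2X, h21⟩
      · rw [finrank_sup_span hw₂ o2, (g Z₁).2.2]
        exact hgf
    · refine (Submodule.eq_of_le_of_finrank_le (sup_le inf_le_right ?_) ?_).symm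
      · rw [Submodule.span_singleton_le_iff_mem, g2]
        exact ⟨h1X, h12⟩
      · rw [finrank_sup_span hw₁ o1, (g Z₂).2.2]
        exact hgf
  refine ⟨⟨⟨g, g', hinv, hinv'⟩, fun {Z₁ Z₂} => ⟨fun h => ?_, fun h => hadj hf hg h⟩⟩, hg⟩
  have := hadj hf' hg' h
  change (orthoGrassmannGraph H k).Adj (g' (g Z₁)) (g' (g Z₂)) at this
  rwa [hinv, hinv] at this

end

/-! ### Semilinear operators and orthocomplements -/

section

variable {H : Type*} [NormedAddCommGroup H] [InnerProductSpace ℂ H]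

section Semilinear

variable {σ σ' : ℂ →+* ℂ} [RingHomInvPair σ σ'] [RingHomInvPair σ' σ]

theorem finrank_map_semilinearEquiv (U : H ≃ₛₗ[σ] H) (X : Submodule ℂ H) :
    finrank ℂ (X.map (U : H →ₛₗ[σ] H)) = finrank ℂ X := by
  have hσ : Function.Bijective σ :=
    ⟨σ.injective, fun z => ⟨σ' z, RingHomInvPair.comp_apply_eq₂⟩⟩
  have := rank_eq_of_equiv_equiv (R := ℂ) (R' := ℂ) σ (U.submoduleMap X).toAddEquiv hσ
    fun r m => (U.submoduleMap X).map_smulₛₗ r m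
  rw [finrank, finrank, this]

theorem orthogonal_map_semilinearEquiv (U : H ≃ₛₗ[σ] H)
    (hU : ∀ x y : H, inner ℂ (U x) (U y) = σ (inner ℂ x y)) (X : Submodule ℂ H) :
    (X.map (U : H →ₛₗ[σ] H))ᗮ = Xᗮ.map (U : H →ₛₗ[σ] H) := by
  ext y
  obtain ⟨z, rfl⟩ := U.surjective y
  rw [Submodule.mem_orthogonal]
  constructor
  · intro h
    refine Submodule.mem_map_of_mem fun x hx => ?_
    have := h _ (Submodule.mem_map_of_mem hx)
    exact (map_eq_zero σ).1 ((hU x z).symm.trans this)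
  · rintro ⟨z', hz', hzz⟩ _ ⟨x, hx, rfl⟩
    rw [← hzz]
    exact (hU x z').trans (by rw [hz' x hx, map_zero])

theorem exists_grassmannian_le_of_mem {k : ℕ} (hk : 0 < k) (X : Grassmannian H (k + 1)) {x : H}
    (hx : x ∈ X.1) : ∃ Z : Grassmannian H k, Z.1 ≤ X.1 ∧ x ∈ Z.1 := by
  have hle : ¬ X.1 ≤ ℂ ∙ x := fun h => by
    have h1 := Submodule.finrank_mono h
    have h2 := X.2.2
    have h3 : finrank ℂ (ℂ ∙ x) ≤ 1 := (finrank_span_le_card {x}).trans (by simp)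
    omega
  obtain ⟨y, hy, hyx, hyX⟩ := exists_orthogonal_of_not_le hle
  rw [sup_eq_right.2 ((Submodule.span_singleton_le_iff_mem _ _).2 hx)] at hyX
  refine ⟨⟨(ℂ ∙ y)ᗮ ⊓ X.1, inferInstance, ?_⟩, inf_le_right, ?_, hx⟩
  · have := Submodule.finrank_add_inf_finrank_orthogonal
      ((Submodule.span_singleton_le_iff_mem _ _).2 hyX)
    rw [finrank_span_singleton hy, X.2.2] at this
    omega
  · refine Submodule.mem_orthogonal_singleton_iff_inner_left.2 ?_
    exact hyx x (Submodule.mem_span_singleton_self x)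

theorem map_eq_of_descent {k : ℕ} (hk : 0 < k) {f : Grassmannian H (k + 1) → Grassmannian H (k + 1)}
    {g : Grassmannian H k → Grassmannian H k}
    (hgf : ∀ (Z : Grassmannian H k) (X : Grassmannian H (k + 1)), Z.1 ≤ X.1 → (g Z).1 ≤ (f X).1)
    (U : H ≃ₛₗ[σ] H) (hg : ∀ Z, (g Z).1 = Z.1.map (U : H →ₛₗ[σ] H)) (X : Grassmannian H (k + 1)) :
    (f X).1 = X.1.map (U : H →ₛₗ[σ] H) := by
  refine (Submodule.eq_of_le_of_finrank_eq ?_ ?_).symm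
  · rintro _ ⟨x, hx, rfl⟩
    obtain ⟨Z, hZX, hxZ⟩ := exists_grassmannian_le_of_mem hk X hx
    refine hgf Z X hZX ?_
    rw [hg]
    exact Submodule.mem_map_of_mem hxZ
  · rw [finrank_map_semilinearEquiv, X.2.2, (f X).2.2]

end Semilinear

theorem isInduced_of_descent {k : ℕ} (hk : 0 < k)
    {f : Grassmannian H (k + 1) → Grassmannian H (k + 1)}
    {g : Grassmannian H k → Grassmannian H k}
    (hgf : ∀ (Z : Grassmannian H k) (X : Grassmannian H (k + 1)), Z.1 ≤ X.1 → (g Z).1 ≤ (f X).1)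
    (hg : IsInducedByUnitaryOrAntiunitary g) : IsInducedByUnitaryOrAntiunitary f := by
  rcases hg with ⟨U, hU, h⟩ | ⟨U, hU, h⟩
  · exact Or.inl ⟨U, hU, map_eq_of_descent hk hgf U h⟩
  · exact Or.inr ⟨U, hU, map_eq_of_descent hk hgf U h⟩

theorem orthogonal_eq_sup_span {X : Submodule ℂ H} {y : H} (hy : y ∈ Xᗮ) :
    Xᗮ = (X ⊔ ℂ ∙ y)ᗮ ⊔ ℂ ∙ y := by
  rw [← Submodule.inf_orthogonal, sup_comm, inf_comm,
    Submodule.sup_orthogonal_inf_of_hasOrthogonalProjection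
      ((Submodule.span_singleton_le_iff_mem _ _).2 hy)]

theorem OrthoAdj.orthogonal {X Y : Submodule ℂ H} (h : OrthoAdj X Y) : OrthoAdj Xᗮ Yᗮ := by
  obtain ⟨B, x, y, hx, hy, hxB, hyB, hxy, rfl, rfl⟩ := h
  refine ⟨(B ⊔ ℂ ∙ x ⊔ ℂ ∙ y)ᗮ, y, x, hy, hx, ?_, ?_, inner_eq_zero_symm.1 hxy, ?_, ?_⟩
  · exact Submodule.le_orthogonal_orthogonal _
      (Submodule.mem_sup_right (Submodule.mem_span_singleton_self y))
  · exact Submodule.le_orthogonal_orthogonal _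
      (Submodule.mem_sup_left (Submodule.mem_sup_right (Submodule.mem_span_singleton_self x)))
  · exact orthogonal_eq_sup_span (mem_sup_span_orthogonal.2 ⟨hyB, hxy⟩)
  · rw [sup_right_comm]
    exact orthogonal_eq_sup_span (mem_sup_span_orthogonal.2 ⟨hxB, inner_eq_zero_symm.1 hxy⟩)

/-- The orthocomplementary map, as an isomorphism between the ortho-Grassmann graphs of
complementary dimensions. -/
noncomputable def orthocomplementIso [FiniteDimensional ℂ H] {k l : ℕ} (h : k + l = finrank ℂ H) :
    orthoGrassmannGraph H k ≃g orthoGrassmannGraph H l where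
  toFun X := ⟨X.1ᗮ, inferInstance, by
    have := X.1.finrank_add_finrank_orthogonal
    have := X.2.2
    omega⟩
  invFun X := ⟨X.1ᗮ, inferInstance, by
    have := X.1.finrank_add_finrank_orthogonal
    have := X.2.2
    omega⟩
  left_inv X := Grassmannian.ext X.1.orthogonal_orthogonal
  right_inv X := Grassmannian.ext X.1.orthogonal_orthogonal
  map_rel_iff' {X Y} := by
    have := FiniteDimensional.complete ℂ H
    rw [adj_iff, adj_iff]
    refine ⟨fun h => ?_, OrthoAdj.orthogonal⟩
    have := OrthoAdj.orthogonal h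
    change OrthoAdj X.1ᗮᗮ Y.1ᗮᗮ at this
    rwa [Submodule.orthogonal_orthogonal, Submodule.orthogonal_orthogonal] at this

theorem orthocomplementIso_apply [FiniteDimensional ℂ H] {k l : ℕ} (h : k + l = finrank ℂ H)
    (X : Grassmannian H k) : (orthocomplementIso h X).1 = X.1ᗮ := rfl

/-- Conjugation by the orthocomplementary map does not change the inducing operator. -/
theorem isInduced_of_conj [FiniteDimensional ℂ H] {k l : ℕ} (h : k + l = finrank ℂ H)
    (f : orthoGrassmannGraph H k ≃g orthoGrassmannGraph H k)
    (hf : IsInducedByUnitaryOrAntiunitary fun X : Grassmannian H l =>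
      orthocomplementIso h (f ((orthocomplementIso h).symm X))) :
    IsInducedByUnitaryOrAntiunitary f := by
  have key : ∀ X, (f X).1 =
      (orthocomplementIso h (f ((orthocomplementIso h).symm (orthocomplementIso h X)))).1ᗮ := by
    intro X
    rw [orthocomplementIso_apply, RelIso.symm_apply_apply, Submodule.orthogonal_orthogonal]
  rcases hf with ⟨U, hU, hf⟩ | ⟨U, hU, hf⟩
  · refine Or.inl ⟨U, hU, fun X => ?_⟩
    rw [key, hf, orthogonal_map_semilinearEquiv U hU, orthocomplementIso_apply,
      Submodule.orthogonal_orthogonal]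
  · refine Or.inr ⟨U, hU, fun X => ?_⟩
    rw [key, hf, orthogonal_map_semilinearEquiv U hU, orthocomplementIso_apply,
      Submodule.orthogonal_orthogonal]

end

/-! ### The fundamental theorem of projective geometry for orthogonality -/

section

variable {H : Type*} [NormedAddCommGroup H] [InnerProductSpace ℂ H]

/-- A bijective correspondence between the lines of `H` that preserves orthogonality in both
directions, written as a relation between nonzero vectors: `R x v` says that the line of `x` goes to
the line of `v`. -/
structure OrthoCorrespondence (R : H → H → Prop) : Prop where
  left_ne : ∀ {x v}, R x v → x ≠ 0
  right_ne : ∀ {x v}, R x v → v ≠ 0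
  exists_right : ∀ {x}, x ≠ 0 → ∃ v, R x v
  exists_left : ∀ {v}, v ≠ 0 → ∃ x, R x v
  smul : ∀ {x v} {c d : ℂ}, R x v → c ≠ 0 → d ≠ 0 → R (c • x) (d • v)
  unique : ∀ {x v w}, R x v → R x w → ∃ c : ℂ, w = c • v
  inner_iff : ∀ {x y v w}, R x v → R y w → (inner ℂ x y = 0 ↔ inner ℂ v w = 0)

/-- An orthogonality-preserving correspondence preserves collinearity, because a plane is the
orthocomplement of its orthocomplement. -/
theorem OrthoCorrespondence.collinear {R : H → H → Prop} (hR : OrthoCorrespondence R)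
    {x a b v α β : H} (hx : R x v) (ha : R a α) (hb : R b β) {s t : ℂ} (h : x = s • a + t • b) :
    ∃ s' t' : ℂ, v = s' • α + t' • β := by
  suffices hv : v ∈ Submodule.span ℂ {α, β} by
    obtain ⟨s', t', h'⟩ := Submodule.mem_span_pair.1 hv
    exact ⟨s', t', h'.symm⟩
  have hfin : FiniteDimensional ℂ (Submodule.span ℂ {α, β}) :=
    FiniteDimensional.span_of_finite ℂ (Set.toFinite _)
  rw [← Submodule.orthogonal_orthogonal (Submodule.span ℂ {α, β})]
  intro u hu
  by_cases hu0 : u = 0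
  · rw [hu0, inner_zero_left]
  obtain ⟨y, hy⟩ := hR.exists_left hu0
  have h1 : inner ℂ α u = 0 := hu α (Submodule.subset_span (by simp))
  have h2 : inner ℂ β u = 0 := hu β (Submodule.subset_span (by simp))
  rw [← hR.inner_iff ha hy, inner_eq_zero_symm] at h1
  rw [← hR.inner_iff hb hy, inner_eq_zero_symm] at h2
  rw [← hR.inner_iff hy hx, h, inner_add_right, inner_smul_right, inner_smul_right, h1, h2,
    mul_zero, mul_zero, add_zero]

/-- The correspondence `R` in the affine chart `e₀ + e₀ᗮ`: the line of `e₀ + x` goes to that of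
`e + V x`, both displacements being orthogonal to the base points. -/
structure IsAffineChart (R : H → H → Prop) (e₀ e : H) (V : H → H) : Prop where
  corr : OrthoCorrespondence R
  base : R e₀ e
  inner_eq : ∀ {x}, inner ℂ e₀ x = 0 → inner ℂ e (V x) = 0
  rel_add : ∀ {x}, inner ℂ e₀ x = 0 → R (e₀ + x) (e + V x)

theorem OrthoCorrespondence.exists_chart {R : H → H → Prop} (hR : OrthoCorrespondence R)
    {e₀ e : H} (he : R e₀ e) : ∃ V, IsAffineChart R e₀ e V := by
  have key : ∀ x, ∃ v, inner ℂ e₀ x = 0 → inner ℂ e v = 0 ∧ R (e₀ + x) (e + v) := by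
    intro x
    by_cases hx : inner ℂ e₀ x = 0
    swap
    · exact ⟨0, fun h => absurd h hx⟩
    have h0 : inner ℂ e₀ (e₀ + x) ≠ 0 := by
      rw [inner_add_right, hx, add_zero]
      exact inner_self_ne_zero.2 (hR.left_ne he)
    have hne : e₀ + x ≠ 0 := fun h => h0 (by rw [h, inner_zero_right])
    obtain ⟨w, hw⟩ := hR.exists_right hne
    have hw0 : inner ℂ e w ≠ 0 := fun h => h0 ((hR.inner_iff he hw).2 h)
    have hee : inner ℂ e e ≠ 0 := inner_self_ne_zero.2 (hR.right_ne he)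
    refine ⟨(inner ℂ e e / inner ℂ e w) • w - e, fun _ => ⟨?_, ?_⟩⟩
    · rw [inner_sub_right, inner_smul_right, div_mul_cancel₀ _ hw0, sub_self]
    · rw [add_sub_cancel]
      simpa using hR.smul hw one_ne_zero (div_ne_zero hee hw0)
  choose V hV using key
  exact ⟨V, hR, he, fun h => (hV _ h).1, fun h => (hV _ h).2⟩

namespace IsAffineChart

variable {R : H → H → Prop} {e₀ e : H} {V : H → H}

theorem inner_self_ne (h : IsAffineChart R e₀ e V) : inner ℂ e e ≠ 0 :=
  inner_self_ne_zero.2 (h.corr.right_ne h.base)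

theorem map_zero (h : IsAffineChart R e₀ e V) : V 0 = 0 := by
  have h0 := h.rel_add (inner_zero_right e₀)
  rw [add_zero] at h0
  obtain ⟨c, hc⟩ := h.corr.unique h.base h0
  have h1 := congrArg (inner ℂ e) hc
  rw [inner_add_right, h.inner_eq (inner_zero_right e₀), add_zero, inner_smul_right] at h1
  have hc1 : c = 1 := mul_right_cancel₀ h.inner_self_ne (by rw [← h1, one_mul])
  simpa [hc1] using hc

theorem rel (h : IsAffineChart R e₀ e V) {x : H} (hx : inner ℂ e₀ x = 0) (hx0 : x ≠ 0) :
    R x (V x) := by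
  obtain ⟨w, hw⟩ := h.corr.exists_right hx0
  obtain ⟨s, t, hst⟩ := h.corr.collinear hw (h.rel_add hx) h.base (s := 1) (t := -1) (by simp)
  have h1 := (h.corr.inner_iff h.base hw).1 hx
  rw [hst, inner_add_right, inner_smul_right, inner_smul_right, inner_add_right, h.inner_eq hx,
    add_zero, ← add_mul] at h1
  have h2 : t = -s := by
    rw [eq_neg_iff_add_eq_zero, add_comm]
    exact (mul_eq_zero.1 h1).resolve_right h.inner_self_ne
  have h3 : w = s • V x := by
    rw [hst, h2]
    module
  have hs : s ≠ 0 := by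
    rintro rfl
    exact h.corr.right_ne hw (by rw [h3, zero_smul])
  have := h.corr.smul hw one_ne_zero (inv_ne_zero hs)
  rwa [one_smul, h3, smul_smul, inv_mul_cancel₀ hs, one_smul] at this

theorem inner_map_self_ne (h : IsAffineChart R e₀ e V) {x : H} (hx : inner ℂ e₀ x = 0)
    (hx0 : x ≠ 0) : inner ℂ (V x) (V x) ≠ 0 :=
  inner_self_ne_zero.2 (h.corr.right_ne (h.rel hx hx0))

theorem inner_map_eq_zero (h : IsAffineChart R e₀ e V) {x y : H} (hx : inner ℂ e₀ x = 0)
    (hy : inner ℂ e₀ y = 0) (hxy : inner ℂ x y = 0) : inner ℂ (V x) (V y) = 0 := by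
  by_cases hx0 : x = 0
  · rw [hx0, h.map_zero, inner_zero_left]
  by_cases hy0 : y = 0
  · rw [hy0, h.map_zero, inner_zero_right]
  exact (h.corr.inner_iff (h.rel hx hx0) (h.rel hy hy0)).1 hxy

theorem map_add_eq (h : IsAffineChart R e₀ e V) {x y : H} (hx : inner ℂ e₀ x = 0)
    (hy : inner ℂ e₀ y = 0) (hy0 : y ≠ 0) : ∃ t : ℂ, V (x + y) = V x + t • V y := by
  have hxy : inner ℂ e₀ (x + y) = 0 := by rw [inner_add_right, hx, hy, add_zero]
  obtain ⟨s, t, hst⟩ := h.corr.collinear (h.rel_add hxy) (h.rel_add hx) (h.rel hy hy0)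
    (s := 1) (t := 1) (by module)
  have h1 := congrArg (inner ℂ e) hst
  rw [inner_add_right, inner_add_right, inner_smul_right, inner_smul_right, inner_add_right,
    h.inner_eq hx, h.inner_eq hy, h.inner_eq hxy, add_zero, mul_zero, add_zero] at h1
  have hs : s = 1 := mul_right_cancel₀ h.inner_self_ne (by rw [← h1, one_mul])
  refine ⟨t, ?_⟩
  rw [hs, one_smul, add_assoc] at hst
  exact add_left_cancel hst

theorem map_add_of_inner_eq_zero (h : IsAffineChart R e₀ e V) {x y : H} (hx : inner ℂ e₀ x = 0)
    (hy : inner ℂ e₀ y = 0) (hxy : inner ℂ x y = 0) : V (x + y) = V x + V y := by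
  by_cases hx0 : x = 0
  · rw [hx0, h.map_zero, zero_add, zero_add]
  by_cases hy0 : y = 0
  · rw [hy0, h.map_zero, add_zero, add_zero]
  obtain ⟨t, ht⟩ := h.map_add_eq hx hy hy0
  obtain ⟨s, hs⟩ := h.map_add_eq hy hx hx0
  rw [add_comm y x, ht] at hs
  have h1 := congrArg (inner ℂ (V y)) hs
  have h0 := h.inner_map_eq_zero hy hx (inner_eq_zero_symm.1 hxy)
  rw [inner_add_right, inner_add_right, inner_smul_right, inner_smul_right, h0, mul_zero, zero_add,
    add_zero] at h1
  have ht1 : t = 1 := mul_right_cancel₀ (h.inner_map_self_ne hy hy0) (by rw [h1, one_mul])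
  rw [ht, ht1, one_smul]

theorem exists_map_smul (h : IsAffineChart R e₀ e V) {x : H} (hx : inner ℂ e₀ x = 0) (a : ℂ) :
    ∃ μ : ℂ, V (a • x) = μ • V x := by
  by_cases ha : a = 0
  · exact ⟨0, by rw [ha, zero_smul, zero_smul, h.map_zero]⟩
  by_cases hx0 : x = 0
  · exact ⟨0, by rw [hx0, smul_zero, zero_smul, h.map_zero]⟩
  have h1 := h.corr.smul (h.rel hx hx0) ha one_ne_zero
  rw [one_smul] at h1
  exact h.corr.unique h1
    (h.rel (by rw [inner_smul_right, hx, mul_zero]) (smul_ne_zero ha hx0))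

/-- Additivity along a line: for a suitable `c`, the vectors `a x + z` and `b x + c z` are
orthogonal, so that additivity is already known for them. -/
theorem map_add_smul (h : IsAffineChart R e₀ e V) {x z : H} (hx : inner ℂ e₀ x = 0)
    (hz : inner ℂ e₀ z = 0) (hxz : inner ℂ x z = 0) (hz0 : z ≠ 0) (a b : ℂ) :
    V ((a + b) • x) = V (a • x) + V (b • x) := by
  by_cases hx0 : x = 0
  · simp only [hx0, smul_zero, h.map_zero, add_zero]
  have hzz : inner ℂ z z ≠ 0 := inner_self_ne_zero.2 hz0
  have hzx := inner_eq_zero_symm.1 hxz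
  have hsm : ∀ {y : H} (d : ℂ), inner ℂ e₀ y = 0 → inner ℂ e₀ (d • y) = 0 := fun d hy => by
    rw [inner_smul_right, hy, mul_zero]
  have hsm' : ∀ c d : ℂ, inner ℂ (c • x) (d • z) = 0 := fun c d => by
    rw [inner_smul_left, inner_smul_right, hxz, mul_zero, mul_zero]
  have hadd : ∀ {y w : H}, inner ℂ e₀ y = 0 → inner ℂ e₀ w = 0 → inner ℂ e₀ (y + w) = 0 :=
    fun hy hw => by rw [inner_add_right, hy, hw, add_zero]
  let c : ℂ := -(starRingEnd ℂ a * b * inner ℂ x x) / inner ℂ z z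
  have horth : inner ℂ (a • x + (1 : ℂ) • z) (b • x + c • z) = 0 := by
    simp only [inner_add_left, inner_add_right, inner_smul_left, inner_smul_right, hxz, hzx]
    simp only [c, _root_.map_one]
    field_simp
    ring
  have e1 := h.map_add_of_inner_eq_zero (hadd (hsm a hx) (hsm 1 hz)) (hadd (hsm b hx) (hsm c hz))
    horth
  rw [h.map_add_of_inner_eq_zero (hsm a hx) (hsm 1 hz) (hsm' a 1),
    h.map_add_of_inner_eq_zero (hsm b hx) (hsm c hz) (hsm' b c)] at e1
  have e2 := h.map_add_of_inner_eq_zero (hsm (a + b) hx) (hsm (1 + c) hz) (hsm' (a + b) (1 + c))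
  have e3 : (a + b) • x + (1 + c) • z = a • x + (1 : ℂ) • z + (b • x + c • z) := by module
  rw [e3, e1] at e2
  obtain ⟨μ₁, h1⟩ := h.exists_map_smul hx a
  obtain ⟨μ₂, h2⟩ := h.exists_map_smul hx b
  obtain ⟨μ₃, h3⟩ := h.exists_map_smul hx (a + b)
  obtain ⟨ν₁, k1⟩ := h.exists_map_smul hz 1
  obtain ⟨ν₂, k2⟩ := h.exists_map_smul hz c
  obtain ⟨ν₃, k3⟩ := h.exists_map_smul hz (1 + c)
  rw [h1, h2, h3, k1, k2, k3] at e2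
  have h0 := h.inner_map_eq_zero hx hz hxz
  have e4 := congrArg (inner ℂ (V x)) e2
  simp only [inner_add_right, inner_smul_right, h0, mul_zero, add_zero] at e4
  have e5 : μ₁ + μ₂ = μ₃ :=
    mul_right_cancel₀ (h.inner_map_self_ne hx hx0) (by rw [add_mul, e4])
  rw [h1, h2, h3, ← e5, add_smul]

/-- In dimension at least three the chart is additive. -/
theorem map_add (h : IsAffineChart R e₀ e V) (h3 : ((3 : ℕ) : Cardinal) ≤ Module.rank ℂ H)
    {x y : H} (hx : inner ℂ e₀ x = 0) (hy : inner ℂ e₀ y = 0) : V (x + y) = V x + V y := by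
  by_cases hx0 : x = 0
  · rw [hx0, h.map_zero, zero_add, zero_add]
  obtain ⟨z, hz, hzV⟩ := exists_mem_orthogonal (V := (ℂ ∙ e₀) ⊔ ℂ ∙ x) <| by
    refine lt_of_lt_of_le ?_ h3
    have h1 := finrank_sup_span_le (ℂ ∙ e₀) x
    have h2 : finrank ℂ (ℂ ∙ e₀) ≤ 1 := (finrank_span_le_card {e₀}).trans (by simp)
    exact_mod_cast (by omega)
  rw [mem_sup_span_orthogonal, Submodule.mem_orthogonal_singleton_iff_inner_right] at hzV
  have hxx : inner ℂ x x ≠ 0 := inner_self_ne_zero.2 hx0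
  obtain ⟨a, w, hw, rfl⟩ : ∃ (a : ℂ) (w : H), inner ℂ x w = 0 ∧ y = a • x + w := by
    refine ⟨inner ℂ x y / inner ℂ x x, y - (inner ℂ x y / inner ℂ x x) • x, ?_, by module⟩
    rw [inner_sub_right, inner_smul_right, div_mul_cancel₀ _ hxx, sub_self]
  have hsm : ∀ d : ℂ, inner ℂ e₀ (d • x) = 0 := fun d => by
    rw [inner_smul_right, hx, mul_zero]
  have hw' : inner ℂ e₀ w = 0 := by rwa [inner_add_right, hsm, zero_add] at hy
  have hsw : ∀ d : ℂ, inner ℂ (d • x) w = 0 := fun d => by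
    rw [inner_smul_left, hw, mul_zero]
  have e1 : x + (a • x + w) = (1 + a) • x + w := by module
  rw [e1, h.map_add_of_inner_eq_zero (hsm _) hw' (hsw _), h.map_add_smul hx hzV.1 hzV.2 hz,
    one_smul, h.map_add_of_inner_eq_zero (hsm _) hw' (hsw _), add_assoc]

/-- The multiplier of a scalar `a` is the same for orthogonal `x` and `y`, by comparison with
`x + y`. -/
theorem map_smul_of_inner_eq_zero (h : IsAffineChart R e₀ e V) {x y : H} (hx : inner ℂ e₀ x = 0)
    (hy : inner ℂ e₀ y = 0) (hxy : inner ℂ x y = 0) (hx0 : x ≠ 0) {a μ : ℂ}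
    (hμ : V (a • x) = μ • V x) : V (a • y) = μ • V y := by
  by_cases hy0 : y = 0
  · rw [hy0, smul_zero, h.map_zero, smul_zero]
  obtain ⟨ν, hν⟩ := h.exists_map_smul hy a
  obtain ⟨ξ, hξ⟩ := h.exists_map_smul
    (by rw [inner_add_right, hx, hy, add_zero] : inner ℂ e₀ (x + y) = 0) a
  rw [smul_add, h.map_add_of_inner_eq_zero hx hy hxy, h.map_add_of_inner_eq_zero
    (by rw [inner_smul_right, hx, mul_zero]) (by rw [inner_smul_right, hy, mul_zero])
    (by rw [inner_smul_left, inner_smul_right, hxy, mul_zero, mul_zero]), hμ, hν] at hξ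
  have h0 := h.inner_map_eq_zero hx hy hxy
  have h1 := congrArg (inner ℂ (V x)) hξ
  have h2 := congrArg (inner ℂ (V y)) hξ
  simp only [inner_add_right, inner_smul_right, h0, inner_eq_zero_symm.1 h0, mul_zero, add_zero,
    zero_add] at h1 h2
  rw [hν, mul_right_cancel₀ (h.inner_map_self_ne hy hy0) h2,
    mul_right_cancel₀ (h.inner_map_self_ne hx hx0) h1]

theorem exists_ringHom (h : IsAffineChart R e₀ e V)
    (h3 : ((3 : ℕ) : Cardinal) ≤ Module.rank ℂ H) :
    ∃ σ : ℂ →+* ℂ, ∀ (a : ℂ) {x : H}, inner ℂ e₀ x = 0 → V (a • x) = σ a • V x := by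
  obtain ⟨v, hv, hvv⟩ := exists_orthogonal_family 2 (ℂ ∙ e₀) <| by
    refine le_trans ?_ h3
    have h2 : finrank ℂ (ℂ ∙ e₀) ≤ 1 := (finrank_span_le_card {e₀}).trans (by simp)
    exact_mod_cast (by omega)
  simp only [Submodule.mem_orthogonal_singleton_iff_inner_right] at hv
  have h01 : inner ℂ (v 0) (v 1) = 0 := hvv 0 1 (by decide)
  obtain ⟨hx0, hx⟩ := hv 0
  obtain ⟨hz0, hz⟩ := hv 1
  generalize v 0 = x₀ at *
  generalize v 1 = z₀ at *
  choose σ hσ using h.exists_map_smul hx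
  have hsm : ∀ {y : H} (d : ℂ), inner ℂ e₀ y = 0 → inner ℂ e₀ (d • y) = 0 := fun d hy => by
    rw [inner_smul_right, hy, mul_zero]
  have key : ∀ (a : ℂ) {x : H}, inner ℂ e₀ x = 0 → V (a • x) = σ a • V x := by
    intro a x hx'
    obtain ⟨b, w, hw, rfl⟩ : ∃ (b : ℂ) (w : H), inner ℂ x₀ w = 0 ∧ x = b • x₀ + w := by
      refine ⟨inner ℂ x₀ x / inner ℂ x₀ x₀, x - (inner ℂ x₀ x / inner ℂ x₀ x₀) • x₀, ?_,
        by module⟩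
      rw [inner_sub_right, inner_smul_right, div_mul_cancel₀ _ (inner_self_ne_zero.2 hx0), sub_self]
    have hw' : inner ℂ e₀ w = 0 := by rwa [inner_add_right, hsm b hx, zero_add] at hx'
    have e1 := h.map_smul_of_inner_eq_zero hx hz h01 hx0 (hσ a)
    have e2 := h.map_smul_of_inner_eq_zero hz (hsm b hx)
      (by rw [inner_smul_right, inner_eq_zero_symm.1 h01, mul_zero]) hz0 e1
    have e3 := h.map_smul_of_inner_eq_zero hx hw' hw hx0 (hσ a)
    rw [smul_add, h.map_add h3 (hsm a (hsm b hx)) (hsm a hw'), e2, e3,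
      h.map_add h3 (hsm b hx) hw', smul_add]
  have hV0 : V x₀ ≠ 0 := h.corr.right_ne (h.rel hx hx0)
  refine ⟨⟨⟨⟨σ, ?_⟩, ?_⟩, ?_, ?_⟩, key⟩
  · refine smul_left_injective ℂ hV0 ?_
    change σ 1 • V x₀ = (1 : ℂ) • V x₀
    rw [← hσ, one_smul, one_smul]
  · intro a b
    refine smul_left_injective ℂ hV0 ?_
    change σ (a * b) • V x₀ = (σ a * σ b) • V x₀
    rw [← hσ, mul_smul, key a (hsm b hx), hσ, smul_smul]
  · refine smul_left_injective ℂ hV0 ?_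
    change σ 0 • V x₀ = (0 : ℂ) • V x₀
    rw [← hσ, zero_smul, zero_smul, h.map_zero]
  · intro a b
    refine smul_left_injective ℂ hV0 ?_
    change σ (a + b) • V x₀ = (σ a + σ b) • V x₀
    rw [← hσ, add_smul, h.map_add h3 (hsm a hx) (hsm b hx), hσ, hσ, add_smul]

end IsAffineChart

/-- The fundamental theorem of projective geometry, for correspondences that preserve orthogonality:
they come from a semilinear map. -/
theorem OrthoCorrespondence.exists_semilinear {R : H → H → Prop} (hR : OrthoCorrespondence R)
    (h3 : ((3 : ℕ) : Cardinal) ≤ Module.rank ℂ H) :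
    ∃ (σ : ℂ →+* ℂ) (T : H →ₛₗ[σ] H), ∀ x, x ≠ 0 → R x (T x) := by
  obtain ⟨e₀, he₀, -⟩ := exists_mem_orthogonal (H := H) (V := ⊥) (by
    rw [finrank_bot]
    exact lt_of_lt_of_le (by norm_num) h3)
  obtain ⟨e, he⟩ := hR.exists_right he₀
  obtain ⟨V, hV⟩ := hR.exists_chart he
  obtain ⟨σ, hσ⟩ := hV.exists_ringHom h3
  have hee : inner ℂ e₀ e₀ ≠ 0 := inner_self_ne_zero.2 he₀
  let A : H →ₗ[ℂ] ℂ := (inner ℂ e₀ e₀)⁻¹ • (innerSL ℂ e₀ : H →ₗ[ℂ] ℂ)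
  have hA : ∀ u, A u = (inner ℂ e₀ e₀)⁻¹ * inner ℂ e₀ u := fun u => rfl
  have hK : ∀ u, inner ℂ e₀ (u - A u • e₀) = 0 := fun u => by
    rw [inner_sub_right, inner_smul_right, hA, mul_right_comm, inv_mul_cancel₀ hee, one_mul,
      sub_self]
  let T : H →ₛₗ[σ] H :=
    { toFun := fun u => σ (A u) • e + V (u - A u • e₀)
      map_add' := fun u v => by
        have : u + v - A (u + v) • e₀ = (u - A u • e₀) + (v - A v • e₀) := by
          rw [map_add]
          module
        rw [this, hV.map_add h3 (hK u) (hK v), map_add, map_add]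
        module
      map_smul' := fun c u => by
        have : c • u - A (c • u) • e₀ = c • (u - A u • e₀) := by
          rw [map_smul, smul_eq_mul]
          module
        rw [this, hσ c (hK u), map_smul, smul_eq_mul, map_mul]
        module }
  refine ⟨σ, T, fun u hu => ?_⟩
  change R u (σ (A u) • e + V (u - A u • e₀))
  by_cases ha : A u = 0
  · have := hK u
    rw [ha, zero_smul, sub_zero] at this ⊢
    rw [map_zero, zero_smul, zero_add]
    exact hV.rel this hu
  · have hσa : σ (A u) ≠ 0 := (map_ne_zero σ).2 ha
    have h1 : inner ℂ e₀ ((A u)⁻¹ • (u - A u • e₀)) = 0 := by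
      rw [inner_smul_right, hK, mul_zero]
    have h2 := hR.smul (hV.rel_add h1) ha hσa
    rw [hσ _ (hK u), smul_add, smul_add, smul_smul, smul_smul, mul_inv_cancel₀ ha, map_inv₀,
      mul_inv_cancel₀ hσa, one_smul, one_smul, add_sub_cancel] at h2
    exact h2

end

/-! ### Wigner's theorem for lines, and the dimensions below the middle -/

section

variable {H : Type*} [NormedAddCommGroup H] [InnerProductSpace ℂ H]

/-- A ring endomorphism of `ℂ` commuting with conjugation restricts to an endomorphism of `ℝ`, hence
fixes `ℝ`. -/
theorem ringHom_eq_id_or_conj (σ : ℂ →+* ℂ)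
    (h : ∀ a, σ (starRingEnd ℂ a) = starRingEnd ℂ (σ a)) :
    σ = RingHom.id ℂ ∨ σ = starRingEnd ℂ := by
  have hre : ∀ r : ℝ, ((σ r).re : ℂ) = σ r := fun r => by
    rw [← Complex.conj_eq_iff_re, ← h, Complex.conj_ofReal]
  let τ : ℝ →+* ℝ :=
    { toFun := fun r => (σ r).re
      map_one' := by simp
      map_zero' := by simp
      map_mul' := fun a b => by
        rw [Complex.ofReal_mul, map_mul, ← hre a, ← hre b, ← Complex.ofReal_mul,
          Complex.ofReal_re, Complex.ofReal_re, Complex.ofReal_re]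
      map_add' := fun a b => by simp }
  have hτ : ∀ r : ℝ, σ r = r := fun r => by
    have h1 : τ r = r := by rw [Subsingleton.elim τ (RingHom.id ℝ), RingHom.id_apply]
    rw [← hre]
    exact congrArg _ h1
  have hI : σ Complex.I = Complex.I ∨ σ Complex.I = -Complex.I := by
    rw [← sq_eq_sq_iff_eq_or_eq_neg, ← map_pow, Complex.I_sq, map_neg, map_one]
  refine hI.imp (fun hI => ?_) fun hI => ?_ <;> ext z
  · rw [← Complex.re_add_im z, map_add, map_mul, hτ, hτ, hI, RingHom.id_apply]
  · rw [← Complex.re_add_im z, map_add, map_mul, hτ, hτ, hI, map_add, map_mul, Complex.conj_ofReal,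
      Complex.conj_ofReal, Complex.conj_I]

section OrthogonalityPreserving

variable {σ : ℂ →+* ℂ} {T : H →ₛₗ[σ] H}

theorem norm_map_eq_of_orthogonal
    (hT : ∀ x y, inner ℂ x y = 0 → inner ℂ (T x) (T y) = 0) {x y : H} (hxy : inner ℂ x y = 0)
    (hn : ‖x‖ = ‖y‖) : ‖T x‖ = ‖T y‖ := by
  have h1 : inner ℂ (x + y) (x - y) = 0 := by
    rw [inner_sub_right, inner_add_left, inner_add_left, hxy, inner_eq_zero_symm.1 hxy,
      inner_self_eq_norm_sq_to_K, inner_self_eq_norm_sq_to_K, hn]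
    ring
  have h2 := hT _ _ h1
  have h3 := hT _ _ hxy
  rw [map_add, map_sub, inner_sub_right, inner_add_left, inner_add_left, h3,
    inner_eq_zero_symm.1 h3, inner_self_eq_norm_sq_to_K, inner_self_eq_norm_sq_to_K, add_zero,
    zero_add, sub_eq_zero] at h2
  have h4 : ‖T x‖ ^ 2 = ‖T y‖ ^ 2 := by exact_mod_cast h2
  exact (sq_eq_sq₀ (norm_nonneg _) (norm_nonneg _)).1 h4

/-- Apply `T` to the orthogonal vectors `x + a y` and `x - (conj a)⁻¹ y`. -/
theorem map_conj_of_orthogonality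
    (hT : ∀ x y, inner ℂ x y = 0 → inner ℂ (T x) (T y) = 0) {x y : H} (hxy : inner ℂ x y = 0)
    (hn : ‖x‖ = ‖y‖) (hTx : T x ≠ 0) (a : ℂ) :
    σ (starRingEnd ℂ a) = starRingEnd ℂ (σ a) := by
  by_cases ha : a = 0
  · simp [ha]
  have hca : starRingEnd ℂ a ≠ 0 := (map_ne_zero _).2 ha
  have hσ : σ (starRingEnd ℂ a) ≠ 0 := (map_ne_zero _).2 hca
  have h1 : inner ℂ (x + a • y) (x - (starRingEnd ℂ a)⁻¹ • y) = 0 := by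
    rw [inner_sub_right, inner_add_left, inner_add_left, inner_smul_left, inner_smul_left,
      inner_smul_right, inner_smul_right, hxy, inner_eq_zero_symm.1 hxy,
      inner_self_eq_norm_sq_to_K, inner_self_eq_norm_sq_to_K, hn]
    field_simp
    ring
  have h2 := hT _ _ h1
  have h3 := hT _ _ hxy
  have hTn : inner ℂ (T x) (T x) = inner ℂ (T y) (T y) := by
    rw [inner_self_eq_norm_sq_to_K, inner_self_eq_norm_sq_to_K, norm_map_eq_of_orthogonal hT hxy hn]
  rw [map_add, map_sub, map_smulₛₗ, map_smulₛₗ, inner_sub_right, inner_add_left, inner_add_left,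
    inner_smul_left, inner_smul_left, inner_smul_right, inner_smul_right, h3,
    inner_eq_zero_symm.1 h3, ← hTn, map_inv₀] at h2
  have h4 : (1 - starRingEnd ℂ (σ a) * (σ (starRingEnd ℂ a))⁻¹) * inner ℂ (T x) (T x) = 0 := by
    rw [← h2]
    ring
  have h5 := (mul_eq_zero.1 h4).resolve_right (inner_self_ne_zero.2 hTx)
  rw [sub_eq_zero, eq_comm, mul_inv_eq_one₀ hσ] at h5
  exact h5.symm

theorem norm_map_eq_mul (hσ : ∀ a, ‖σ a‖ = ‖a‖)
    (hT : ∀ x y, inner ℂ x y = 0 → inner ℂ (T x) (T y) = 0) {u : H} (hu : ‖u‖ = 1) (v : H) :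
    ‖T v‖ = ‖T u‖ * ‖v‖ := by
  have key : ∀ w, inner ℂ u w = 0 → ‖T w‖ = ‖T u‖ * ‖w‖ := fun w hw => by
    have h1 : ‖(‖w‖ : ℂ) • u‖ = ‖w‖ := by rw [norm_smul, hu]; simp
    have h2 := norm_map_eq_of_orthogonal hT (x := (‖w‖ : ℂ) • u) (y := w)
      (by rw [inner_smul_left, hw, mul_zero]) h1
    rw [← h2, map_smulₛₗ, norm_smul, hσ, mul_comm]
    simp
  obtain ⟨a, w, hw, rfl⟩ : ∃ (a : ℂ) (w : H), inner ℂ u w = 0 ∧ v = a • u + w := by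
    refine ⟨inner ℂ u v, v - inner ℂ u v • u, ?_, by module⟩
    rw [inner_sub_right, inner_smul_right, inner_self_eq_norm_sq_to_K, hu]
    simp
  have hw' : inner ℂ (a • u) w = 0 := by rw [inner_smul_left, hw, mul_zero]
  have h1 := norm_add_sq_eq_norm_sq_add_norm_sq_of_inner_eq_zero (𝕜 := ℂ) (a • u) w hw'
  have h2 := norm_add_sq_eq_norm_sq_add_norm_sq_of_inner_eq_zero (𝕜 := ℂ) _ _ (hT _ _ hw')
  rw [← map_add, map_smulₛₗ, norm_smul, hσ, key w hw] at h2
  rw [norm_smul, hu] at h1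
  rw [← mul_self_inj_of_nonneg (norm_nonneg _) (by positivity), h2]
  linear_combination -(‖T u‖ ^ 2) * h1

theorem inner_map_map_eq (hσ : ∀ a, ‖σ a‖ = ‖a‖) (hσr : ∀ r : ℝ, σ r = r)
    (hT : ∀ x y, inner ℂ x y = 0 → inner ℂ (T x) (T y) = 0) {u : H} (hu : ‖u‖ = 1) (x y : H) :
    inner ℂ (T x) (T y) = (‖T u‖ : ℂ) ^ 2 * σ (inner ℂ x y) := by
  by_cases hx : x = 0
  · simp [hx]
  have hxx : inner ℂ x x ≠ 0 := inner_self_ne_zero.2 hx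
  obtain ⟨a, w, hw, rfl⟩ : ∃ (a : ℂ) (w : H), inner ℂ x w = 0 ∧ y = a • x + w := by
    refine ⟨inner ℂ x y / inner ℂ x x, y - (inner ℂ x y / inner ℂ x x) • x, ?_, by module⟩
    rw [inner_sub_right, inner_smul_right, div_mul_cancel₀ _ hxx, sub_self]
  rw [map_add, map_smulₛₗ, inner_add_right, inner_add_right, inner_smul_right, inner_smul_right, hw,
    hT _ _ hw, add_zero, add_zero, map_mul, inner_self_eq_norm_sq_to_K, inner_self_eq_norm_sq_to_K,
    norm_map_eq_mul hσ hT hu x, map_pow]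
  simp only [Complex.coe_algebraMap, hσr]
  push_cast
  ring

end OrthogonalityPreserving

/-- Rescaling an orthogonality-preserving semilinear map that is onto on lines gives a semilinear
bijection compatible with the inner product. -/
theorem exists_equiv_of_orthogonality {σ : ℂ →+* ℂ} [RingHomInvPair σ σ]
    (hσ : ∀ a, ‖σ a‖ = ‖a‖) (hσr : ∀ r : ℝ, σ r = r) (T : H →ₛₗ[σ] H)
    (hT : ∀ x y, inner ℂ x y = 0 → inner ℂ (T x) (T y) = 0) {u : H} (hu : ‖u‖ = 1)
    (hTu : T u ≠ 0) (hsurj : ∀ y, ∃ (c : ℂ) (x : H), y = c • T x) :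
    ∃ U : H ≃ₛₗ[σ] H, (∀ x y, inner ℂ (U x) (U y) = σ (inner ℂ x y)) ∧
      ∃ c : ℂ, c ≠ 0 ∧ ∀ x, U x = c • T x := by
  have hn : (‖T u‖ : ℂ) ≠ 0 := by simpa using hTu
  have hinner : ∀ x y, inner ℂ (((‖T u‖ : ℂ)⁻¹ • T) x) (((‖T u‖ : ℂ)⁻¹ • T) y) =
      σ (inner ℂ x y) := fun x y => by
    rw [LinearMap.smul_apply, LinearMap.smul_apply, inner_smul_left, inner_smul_right,
      inner_map_map_eq hσ hσr hT hu, map_inv₀, Complex.conj_ofReal]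
    field_simp
  have hinj : Function.Injective ((‖T u‖ : ℂ)⁻¹ • T) := by
    refine (injective_iff_map_eq_zero _).2 fun x hx => ?_
    have := hinner x x
    rw [hx, inner_zero_left, eq_comm, map_eq_zero] at this
    exact inner_self_eq_zero.1 this
  have hsur : Function.Surjective ((‖T u‖ : ℂ)⁻¹ • T) := fun y => by
    obtain ⟨c, x, rfl⟩ := hsurj y
    refine ⟨σ (‖T u‖ * c) • x, ?_⟩
    rw [map_smulₛₗ, RingHomInvPair.comp_apply_eq, LinearMap.smul_apply, smul_smul, mul_right_comm,
      mul_inv_cancel₀ hn, one_mul]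
  exact ⟨LinearEquiv.ofBijective _ ⟨hinj, hsur⟩, hinner, _, inv_ne_zero hn, fun x => rfl⟩

variable [CompleteSpace H]

/-- An automorphism of the graph of lines is an orthogonality-preserving correspondence. -/
theorem orthoCorrespondence_of_iso (f : orthoGrassmannGraph H 1 ≃g orthoGrassmannGraph H 1) :
    OrthoCorrespondence fun x v : H => x ≠ 0 ∧ v ≠ 0 ∧
      ∀ X : Grassmannian H 1, X.1 = ℂ ∙ x → (f X).1 = ℂ ∙ v := by
  have hL : ∀ {x : H}, x ≠ 0 → ∃ X : Grassmannian H 1, X.1 = ℂ ∙ x := fun {x} hx =>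
    ⟨⟨ℂ ∙ x, inferInstance, finrank_span_singleton hx⟩, rfl⟩
  have hline : ∀ X : Grassmannian H 1, ∃ x, x ≠ 0 ∧ X.1 = ℂ ∙ x := fun X => by
    obtain ⟨x, hx, -, hX⟩ := exists_eq_sup_span (bot_le : ⊥ ≤ X.1) (by rw [finrank_bot, X.2.2])
    exact ⟨x, hx, by rwa [bot_sup_eq] at hX⟩
  have hadj : ∀ {x y : H} {X Y : Grassmannian H 1}, x ≠ 0 → y ≠ 0 → X.1 = ℂ ∙ x → Y.1 = ℂ ∙ y →
      ((orthoGrassmannGraph H 1).Adj X Y ↔ inner ℂ x y = 0) := fun hx hy hX hY =>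
    adj_iff_inner_eq_zero (Z := ⊥) hx hy (by simp) (by simp) (by rwa [bot_sup_eq])
      (by rwa [bot_sup_eq])
  refine ⟨fun h => h.1, fun h => h.2.1, ?_, ?_, ?_, ?_, ?_⟩
  · intro x hx
    obtain ⟨X, hX⟩ := hL hx
    obtain ⟨v, hv, hfX⟩ := hline (f X)
    refine ⟨v, hx, hv, fun X' hX' => ?_⟩
    rwa [Grassmannian.ext (hX'.trans hX.symm)]
  · intro v hv
    obtain ⟨Y, hY⟩ := hL hv
    obtain ⟨x, hx, hfY⟩ := hline (f.symm Y)
    refine ⟨x, hx, hv, fun X' hX' => ?_⟩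
    rwa [Grassmannian.ext (hX'.trans hfY.symm), RelIso.apply_symm_apply]
  · rintro x v c d ⟨hx, hv, h⟩ hc hd
    refine ⟨smul_ne_zero hc hx, smul_ne_zero hd hv, fun X hX => ?_⟩
    rw [Submodule.span_singleton_smul_eq (IsUnit.mk0 _ hc)] at hX
    rw [Submodule.span_singleton_smul_eq (IsUnit.mk0 _ hd), h X hX]
  · rintro x v w ⟨hx, hv, h⟩ ⟨-, hw, h'⟩
    obtain ⟨X, hX⟩ := hL hx
    have : w ∈ ℂ ∙ v := by
      rw [← h X hX, h' X hX]
      exact Submodule.mem_span_singleton_self w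
    obtain ⟨c, hc⟩ := Submodule.mem_span_singleton.1 this
    exact ⟨c, hc.symm⟩
  · rintro x y v w ⟨hx, hv, h⟩ ⟨hy, hw, h'⟩
    obtain ⟨X, hX⟩ := hL hx
    obtain ⟨Y, hY⟩ := hL hy
    rw [← hadj hx hy hX hY, ← hadj hv hw (h X hX) (h' Y hY), f.map_adj_iff]

/-- Uhlhorn's version of Wigner's theorem: the case of lines. -/
theorem isInduced_of_lines (h3 : ((3 : ℕ) : Cardinal) ≤ Module.rank ℂ H)
    (f : orthoGrassmannGraph H 1 ≃g orthoGrassmannGraph H 1) :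
    IsInducedByUnitaryOrAntiunitary f := by
  have hR := orthoCorrespondence_of_iso f
  obtain ⟨σ, T, hRT⟩ := hR.exists_semilinear h3
  have hT : ∀ x y, inner ℂ x y = 0 → inner ℂ (T x) (T y) = 0 := by
    intro x y hxy
    by_cases hx : x = 0
    · rw [hx, map_zero, inner_zero_left]
    by_cases hy : y = 0
    · rw [hy, map_zero, inner_zero_right]
    exact (hR.inner_iff (hRT x hx) (hRT y hy)).1 hxy
  have hsurj : ∀ y, ∃ (c : ℂ) (x : H), y = c • T x := by
    intro y
    by_cases hy : y = 0
    · exact ⟨0, 0, by rw [hy, zero_smul]⟩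
    obtain ⟨x, hx⟩ := hR.exists_left hy
    obtain ⟨c, hc⟩ := hR.unique (hRT x (hR.left_ne hx)) hx
    exact ⟨c, x, hc⟩
  obtain ⟨v, hv, hvv⟩ := exists_orthogonal_family 2 (⊥ : Submodule ℂ H) (by
    rw [finrank_bot]
    exact le_trans (by exact_mod_cast (by omega)) h3)
  have hunit : ∀ i, ‖((‖v i‖ : ℂ)⁻¹) • v i‖ = 1 := fun i => norm_smul_inv_norm (hv i).1
  have h01 : inner ℂ (((‖v 0‖ : ℂ)⁻¹) • v 0) (((‖v 1‖ : ℂ)⁻¹) • v 1) = 0 := by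
    rw [inner_smul_left, inner_smul_right, hvv 0 1 (by decide), mul_zero, mul_zero]
  have hu := hunit 0
  have hu' := hu.trans (hunit 1).symm
  generalize ((‖v 0‖ : ℂ)⁻¹) • v 0 = u at *
  have hu0 : u ≠ 0 := by
    rintro rfl
    simp at hu
  have hTu : T u ≠ 0 := hR.right_ne (hRT u hu0)
  have hmap : ∀ {v : H → H} {c : ℂ}, c ≠ 0 → (∀ x, v x = c • T x) → ∀ X : Grassmannian H 1,
      ∃ x, X.1 = ℂ ∙ x ∧ (f X).1 = ℂ ∙ v x := by
    intro v c hc hvT X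
    obtain ⟨x, hx, -, hX⟩ := exists_eq_sup_span (bot_le : ⊥ ≤ X.1) (by rw [finrank_bot, X.2.2])
    rw [bot_sup_eq] at hX
    refine ⟨x, hX, ?_⟩
    rw [hvT, Submodule.span_singleton_smul_eq (IsUnit.mk0 _ hc)]
    exact (hRT x hx).2.2 X hX
  rcases ringHom_eq_id_or_conj σ (map_conj_of_orthogonality hT h01 hu' hTu) with rfl | rfl
  · obtain ⟨U, hU, c, hc, hUT⟩ := exists_equiv_of_orthogonality (fun _ => rfl) (fun _ => rfl) T hT
      hu hTu hsurj
    refine Or.inl ⟨U, hU, fun X => ?_⟩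
    obtain ⟨x, hX, hfX⟩ := hmap hc hUT X
    rw [hfX, hX, Submodule.map_span, Set.image_singleton]
    rfl
  · obtain ⟨U, hU, c, hc, hUT⟩ := exists_equiv_of_orthogonality (fun a => RCLike.norm_conj a)
      Complex.conj_ofReal T hT hu hTu hsurj
    refine Or.inr ⟨U, hU, fun X => ?_⟩
    obtain ⟨x, hX, hfX⟩ := hmap hc hUT X
    rw [hfX, hX, Submodule.map_span, Set.image_singleton]
    rfl

theorem isInduced_of_two_mul_lt {k : ℕ} (hk : 0 < k)
    (h : ((2 * k + 1 : ℕ) : Cardinal) ≤ Module.rank ℂ H)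
    (f : orthoGrassmannGraph H k ≃g orthoGrassmannGraph H k) :
    IsInducedByUnitaryOrAntiunitary f := by
  induction k, hk using Nat.le_induction with
  | base => exact isInduced_of_lines (by simpa using h) f
  | succ k hk ih =>
    obtain ⟨g, hg⟩ := exists_descent (le_trans (by exact_mod_cast (by omega)) h) f
      fun h12 h13 h23 => isStar_map_iff h f h12 h13 h23
    exact isInduced_of_descent hk hg (ih (le_trans (by exact_mod_cast (by omega)) h) g)

end

/-! ### Connectedness, and star triangles on a common edge -/

section

variable {H : Type*} [NormedAddCommGroup H] [InnerProductSpace ℂ H]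
variable {k : ℕ} {X Y X₁ X₂ X₃ X₄ : Grassmannian H k}

theorem finrank_sup_le_of_le {Z V : Submodule ℂ H} [FiniteDimensional ℂ V]
    (hZ : finrank ℂ Z + 1 = k) (hZV : Z ≤ V) (hZX : Z ≤ X.1) :
    finrank ℂ (V ⊔ X.1 : Submodule ℂ H) ≤ finrank ℂ V + 1 := by
  have h1 := Submodule.finrank_sup_add_finrank_inf_eq V X.1
  have h2 := Submodule.finrank_mono (le_inf hZV hZX)
  have h3 := X.2.2
  omega

theorem mem_of_mem_sup_span {P : Submodule ℂ H} {z v : H} (hz : z ∈ Pᗮ)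
    (hv : v ∈ P ⊔ ℂ ∙ z) (hzv : inner ℂ z v = 0) : v ∈ P := by
  obtain ⟨p, hp, w, hw, rfl⟩ := Submodule.mem_sup.1 hv
  obtain ⟨c, rfl⟩ := Submodule.mem_span_singleton.1 hw
  rw [inner_add_right, inner_eq_zero_symm.1 (hz p hp), zero_add, inner_smul_right, mul_eq_zero,
    inner_self_eq_zero] at hzv
  rcases hzv with rfl | rfl <;> simpa using hp

variable [CompleteSpace H]

/-- A vertex through `Z` adjacent to all vertices between `Z` and `V`: a direction orthogonal to
`V`. -/
theorem exists_adj_of_lt {Z V : Submodule ℂ H} [FiniteDimensional ℂ V]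
    (hZ : finrank ℂ Z + 1 = k) (hZV : Z ≤ V) (hV : (finrank ℂ V : Cardinal) < Module.rank ℂ H) :
    ∃ N : Grassmannian H k, Z ≤ N.1 ∧
      ∀ X : Grassmannian H k, Z ≤ X.1 → X.1 ≤ V → (orthoGrassmannGraph H k).Adj N X := by
  have hfin : FiniteDimensional ℂ Z := Submodule.finiteDimensional_of_le hZV
  obtain ⟨u, hu, huV⟩ := exists_mem_orthogonal hV
  obtain ⟨N, hN⟩ := exists_grassmannian_eq_sup_span hZ hu (Submodule.orthogonal_le hZV huV)
  refine ⟨N, le_sup_left.trans hN.ge, fun X hZX hXV => ?_⟩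
  obtain ⟨x, hx, hxZ, hX⟩ := exists_eq_sup_span hZX (hZ.trans X.2.2.symm)
  refine (adj_iff_inner_eq_zero hu hx (Submodule.orthogonal_le hZV huV) hxZ hN hX).2 ?_
  refine inner_eq_zero_symm.1 (huV x (hXV ?_))
  rw [hX]
  exact Submodule.mem_sup_right (Submodule.mem_span_singleton_self x)

theorem exists_adj_three (hk : ((k + 3 : ℕ) : Cardinal) ≤ Module.rank ℂ H) {Z : Submodule ℂ H}
    (hZ : finrank ℂ Z + 1 = k) (h1 : Z ≤ X₁.1) (h2 : Z ≤ X₂.1) (h3 : Z ≤ X₃.1) :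
    ∃ N : Grassmannian H k, Z ≤ N.1 ∧ (orthoGrassmannGraph H k).Adj N X₁ ∧
      (orthoGrassmannGraph H k).Adj N X₂ ∧ (orthoGrassmannGraph H k).Adj N X₃ := by
  have e1 := finrank_sup_le_of_le hZ h1 h2
  have e2 := finrank_sup_le_of_le hZ (h1.trans (le_sup_left : _ ≤ X₁.1 ⊔ X₂.1)) h3
  have e3 := X₁.2.2
  obtain ⟨N, hN, h⟩ := exists_adj_of_lt (V := X₁.1 ⊔ X₂.1 ⊔ X₃.1) hZ
    (h1.trans (le_sup_left.trans le_sup_left))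
    (lt_of_lt_of_le (by exact_mod_cast (by omega)) hk)
  exact ⟨N, hN, h _ h1 (le_sup_left.trans le_sup_left), h _ h2 (le_sup_right.trans le_sup_left),
    h _ h3 le_sup_right⟩

/-- The ortho-Grassmann graph is connected, stated for predicates closed under adjacency. -/
theorem forall_of_adj_closed (hk : ((k + 3 : ℕ) : Cardinal) ≤ Module.rank ℂ H)
    (P : Grassmannian H k → Prop)
    (hP : ∀ {X Y}, (orthoGrassmannGraph H k).Adj X Y → P X → P Y) (hX : P X) (Y) : P Y := by
  induction hd : k - finrank ℂ (X.1 ⊓ Y.1 : Submodule ℂ H) using Nat.strong_induction_on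
    generalizing X with
  | _ d ih =>
  by_cases hle : Y.1 ≤ X.1
  · rwa [Grassmannian.eq_of_le hle]
  have hle' : ¬ X.1 ≤ X.1 ⊓ Y.1 := fun h =>
    hle (congrArg Subtype.val (Grassmannian.eq_of_le (h.trans inf_le_right))).ge
  obtain ⟨x, hx, hxI, hxX⟩ := exists_orthogonal_of_not_le hle'
  rw [sup_eq_right.2 inf_le_left] at hxX
  -- `Z` is a hyperplane of `X` containing `X ∩ Y`; exchanging `x` for `y` moves `X` towards `Y`.
  obtain ⟨Z, hZ, hIZ, hZX⟩ : ∃ Z : Submodule ℂ H,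
      finrank ℂ Z + 1 = k ∧ X.1 ⊓ Y.1 ≤ Z ∧ Z ≤ X.1 := by
    refine ⟨(ℂ ∙ x)ᗮ ⊓ X.1, ?_, le_inf (fun v hv => ?_) inf_le_left, inf_le_right⟩
    · have := Submodule.finrank_add_inf_finrank_orthogonal
        ((Submodule.span_singleton_le_iff_mem _ _).2 hxX)
      rw [finrank_span_singleton hx, X.2.2] at this
      omega
    · exact Submodule.mem_orthogonal_singleton_iff_inner_left.2 (hxI v hv)
  have hfin : FiniteDimensional ℂ Z := Submodule.finiteDimensional_of_le hZX
  obtain ⟨y, hyY, hyX⟩ := SetLike.not_le_iff_exists.1 hle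
  have hlt : ∀ {A : Submodule ℂ H}, A ≤ X.1 → A < A ⊔ ℂ ∙ y := fun {A} hA =>
    lt_of_le_of_ne le_sup_left fun h => hyX (hA (h ▸
      Submodule.mem_sup_right (Submodule.mem_span_singleton_self y)))
  have hfZ := Submodule.finrank_lt_finrank_of_lt (hlt hZX)
  have hfZ' := finrank_sup_span_le Z y
  obtain ⟨X', hX'⟩ : ∃ X' : Grassmannian H k, X'.1 = Z ⊔ ℂ ∙ y :=
    ⟨⟨Z ⊔ ℂ ∙ y, inferInstance, by omega⟩, rfl⟩
  obtain ⟨N, -, hNX, hNX', -⟩ := exists_adj_three hk hZ hZX (le_sup_left.trans hX'.ge)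
    (le_sup_left.trans hX'.ge)
  refine ih _ ?_ (hP hNX' (hP hNX.symm hX)) rfl
  have h1 := Submodule.finrank_lt_finrank_of_lt (hlt (inf_le_left : X.1 ⊓ Y.1 ≤ X.1))
  have h2 : X.1 ⊓ Y.1 ⊔ ℂ ∙ y ≤ X'.1 ⊓ Y.1 := by
    rw [hX']
    exact le_inf (sup_le_sup_right hIZ _)
      (sup_le inf_le_right ((Submodule.span_singleton_le_iff_mem _ _).2 hyY))
  have h3 := Submodule.finrank_mono h2
  have h4 := Submodule.finrank_mono (inf_le_right : X'.1 ⊓ Y.1 ≤ Y.1)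
  rw [Y.2.2] at h4
  omega

/-- If a star triangle and a triangle of the other type share the edge `P₁P₂`, then `P₂` is not the
only vertex adjacent to the three others. -/
theorem exists_second_neighbor {P₁ P₂ P₃ P₄ : Grassmannian H k}
    (h12 : (orthoGrassmannGraph H k).Adj P₁ P₂) (h13 : (orthoGrassmannGraph H k).Adj P₁ P₃)
    (h23 : (orthoGrassmannGraph H k).Adj P₂ P₃) (h14 : (orthoGrassmannGraph H k).Adj P₁ P₄)
    (h24 : (orthoGrassmannGraph H k).Adj P₂ P₄) (h3 : IsStar P₁ P₂ P₃) (h4 : ¬ IsStar P₁ P₂ P₄) :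
    ∃ Q, Q ≠ P₂ ∧ (orthoGrassmannGraph H k).Adj Q P₁ ∧ (orthoGrassmannGraph H k).Adj Q P₃ ∧
      (orthoGrassmannGraph H k).Adj Q P₄ := by
  have hZ := finrank_inf_of_adj h12
  have hsup := finrank_sup_of_adj h12
  have hle := le_sup_of_not_isStar h12 h14 h24 h4
  obtain ⟨z, hz, hz4, hW⟩ := exists_eq_sup_span hle
    ((congrArg (· + 1) P₄.2.2).trans hsup.symm)
  have hzW : z ∈ P₁.1 ⊔ P₂.1 := by
    rw [hW]
    exact Submodule.mem_sup_right (Submodule.mem_span_singleton_self z)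
  have hz1 : z ∈ P₁.1 := mem_of_adj_of_mem_orthogonal h14.symm
    (by rwa [sup_comm, sup_eq_of_adj h14 le_sup_left hle hsup]) hz4
  have hz2 : z ∈ P₂.1 := mem_of_adj_of_mem_orthogonal h24.symm
    (by rwa [sup_comm, sup_eq_of_adj h24 le_sup_right hle hsup]) hz4
  -- `P₁ = A + z + p₁`, `P₂ = A + z + p₂`, `P₃ = A + z + p₃` and `P₄ = A + p₁ + p₂`;
  -- the vertex sought is `A + p₁ + p₃`.
  obtain ⟨A, hA, hzA, hAz⟩ : ∃ A : Submodule ℂ H, finrank ℂ A + 2 = k ∧ z ∈ Aᗮ ∧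
      P₁.1 ⊓ P₂.1 = A ⊔ ℂ ∙ z := by
    have hzle : ℂ ∙ z ≤ P₁.1 ⊓ P₂.1 := (Submodule.span_singleton_le_iff_mem _ _).2 ⟨hz1, hz2⟩
    refine ⟨(ℂ ∙ z)ᗮ ⊓ (P₁.1 ⊓ P₂.1), ?_, ?_, ?_⟩
    · have := Submodule.finrank_add_inf_finrank_orthogonal hzle
      rw [finrank_span_singleton hz] at this
      omega
    · exact fun v hv => Submodule.mem_orthogonal_singleton_iff_inner_left.1 hv.1
    · rw [sup_comm, Submodule.sup_orthogonal_inf_of_hasOrthogonalProjection hzle]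
  have hfin : FiniteDimensional ℂ A :=
    Submodule.finiteDimensional_of_le (le_sup_left.trans hAz.ge)
  obtain ⟨p₁, hp₁, hpZ₁, hP₁⟩ := exists_eq_sup_span (inf_le_left : P₁.1 ⊓ P₂.1 ≤ P₁.1)
    (hZ.trans P₁.2.2.symm)
  obtain ⟨p₂, hp₂, hpZ₂, hP₂⟩ := exists_eq_sup_span (inf_le_right : P₁.1 ⊓ P₂.1 ≤ P₂.1)
    (hZ.trans P₂.2.2.symm)
  obtain ⟨p₃, hp₃, hpZ₃, hP₃⟩ := exists_eq_sup_span h3 (hZ.trans P₃.2.2.symm)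
  have i12 := (adj_iff_inner_eq_zero hp₁ hp₂ hpZ₁ hpZ₂ hP₁ hP₂).1 h12
  have i13 := (adj_iff_inner_eq_zero hp₁ hp₃ hpZ₁ hpZ₃ hP₁ hP₃).1 h13
  have i23 := (adj_iff_inner_eq_zero hp₂ hp₃ hpZ₂ hpZ₃ hP₂ hP₃).1 h23
  rw [hAz] at hP₁ hP₂ hP₃ hpZ₁ hpZ₂ hpZ₃
  rw [mem_sup_span_orthogonal] at hpZ₁ hpZ₂ hpZ₃
  have hA1 : A ⊔ ℂ ∙ p₁ ≤ P₁.1 := by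
    rw [hP₁]
    exact sup_le_sup_right le_sup_left _
  have hp2P : p₂ ∈ P₂.1 := by
    rw [hP₂]
    exact Submodule.mem_sup_right (Submodule.mem_span_singleton_self _)
  have hmem4 : ∀ v ∈ P₁.1 ⊔ P₂.1, inner ℂ z v = 0 → v ∈ P₄.1 := fun v hv hzv =>
    mem_of_mem_sup_span hz4 (hW ▸ hv) hzv
  have hp2A : p₂ ∈ (A ⊔ ℂ ∙ p₁)ᗮ := mem_sup_span_orthogonal.2 ⟨hpZ₂.1, i12⟩
  have hp3A : p₃ ∈ (A ⊔ ℂ ∙ p₁)ᗮ := mem_sup_span_orthogonal.2 ⟨hpZ₃.1, i13⟩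
  have hzA1 : z ∈ (A ⊔ ℂ ∙ p₁)ᗮ :=
    mem_sup_span_orthogonal.2 ⟨hzA, inner_eq_zero_symm.1 hpZ₁.2⟩
  have hfA1 : finrank ℂ (A ⊔ ℂ ∙ p₁ : Submodule ℂ H) + 1 = k := by
    rw [finrank_sup_span hp₁ hpZ₁.1]
    omega
  have hP₄ : P₄.1 = A ⊔ ℂ ∙ p₁ ⊔ ℂ ∙ p₂ := by
    refine (Submodule.eq_of_le_of_finrank_eq (sup_le (fun v hv => hmem4 v ?_ ?_) ?_) ?_).symm
    · exact Submodule.mem_sup_left (hA1 hv)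
    · exact inner_eq_zero_symm.1 (hzA1 v hv)
    · rw [Submodule.span_singleton_le_iff_mem]
      exact hmem4 _ (Submodule.mem_sup_right hp2P) hpZ₂.2
    · rw [finrank_sup_span hp₂ hp2A, hfA1, P₄.2.2]
  obtain ⟨Q, hQ⟩ := exists_grassmannian_eq_sup_span hfA1 hp₃ hp3A
  refine ⟨Q, ?_, ?_, ?_, ?_⟩
  · rintro rfl
    have h1 : p₂ ∈ A ⊔ ℂ ∙ p₁ ⊔ ℂ ∙ p₃ := hQ ▸ hp2P
    have h2 : p₂ ∈ (A ⊔ ℂ ∙ p₁ ⊔ ℂ ∙ p₃)ᗮ :=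
      mem_sup_span_orthogonal.2 ⟨hp2A, inner_eq_zero_symm.1 i23⟩
    exact hp₂ (inner_self_eq_zero.1 (h2 p₂ h1))
  · exact (adj_iff_inner_eq_zero hp₃ hz hp3A hzA1 hQ (by rw [hP₁, sup_right_comm])).2
      (inner_eq_zero_symm.1 hpZ₃.2)
  · exact (adj_iff_inner_eq_zero (Z := A ⊔ ℂ ∙ p₃) hp₁ hz
      (mem_sup_span_orthogonal.2 ⟨hpZ₁.1, inner_eq_zero_symm.1 i13⟩)
      (mem_sup_span_orthogonal.2 ⟨hzA, inner_eq_zero_symm.1 hpZ₃.2⟩)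
      (by rw [hQ, sup_right_comm]) (by rw [hP₃, sup_right_comm])).2 (inner_eq_zero_symm.1 hpZ₁.2)
  · exact (adj_iff_inner_eq_zero hp₃ hp₂ hp3A hp2A hQ hP₄).2 (inner_eq_zero_symm.1 i23)

theorem mem_orthogonal_of_star_direction {Z : Submodule ℂ H} {y : H} (hy : y ≠ 0) (hyZ : y ∈ Zᗮ)
    (hY : Y.1 = Z ⊔ ℂ ∙ y) (hZX : Z ≤ X.1) (h : (orthoGrassmannGraph H k).Adj X Y) :
    y ∈ X.1ᗮ := by
  have hfin : FiniteDimensional ℂ Z := Submodule.finiteDimensional_of_le hZX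
  have h1 := Y.2.2
  rw [hY, finrank_sup_span hy hyZ] at h1
  obtain ⟨x, hx, hxZ, hX⟩ := exists_eq_sup_span hZX (h1.trans X.2.2.symm)
  rw [hX]
  exact mem_sup_span_orthogonal.2 ⟨hyZ, (adj_iff_inner_eq_zero hx hy hxZ hyZ hX hY).1 h⟩

/-- In dimension at most `k + 3` the situation of `exists_second_neighbor` does not occur for two
different star triangles. -/
theorem eq_of_adj_of_isStar [FiniteDimensional ℂ H] (hn : finrank ℂ H ≤ k + 3)
    (h12 : (orthoGrassmannGraph H k).Adj X₁ X₂) (h13 : (orthoGrassmannGraph H k).Adj X₁ X₃)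
    (h23 : (orthoGrassmannGraph H k).Adj X₂ X₃) (h14 : (orthoGrassmannGraph H k).Adj X₁ X₄)
    (h24 : (orthoGrassmannGraph H k).Adj X₂ X₄) (h3 : IsStar X₁ X₂ X₃) (h4 : IsStar X₁ X₂ X₄)
    (hne : X₃ ≠ X₄) {N : Grassmannian H k} (hN1 : (orthoGrassmannGraph H k).Adj N X₁)
    (hN3 : (orthoGrassmannGraph H k).Adj N X₃) (hN4 : (orthoGrassmannGraph H k).Adj N X₄) :
    N = X₂ := by
  have hZ := finrank_inf_of_adj h12
  have e13 := h3.inf_eq h12 h13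
  have e14 := h4.inf_eq h12 h14
  obtain ⟨x₂, hx₂, hxZ₂, hX₂⟩ := exists_eq_sup_span (inf_le_right : X₁.1 ⊓ X₂.1 ≤ X₂.1)
    (hZ.trans X₂.2.2.symm)
  obtain ⟨x₃, hx₃, hxZ₃, hX₃⟩ := exists_eq_sup_span h3 (hZ.trans X₃.2.2.symm)
  obtain ⟨x₄, hx₄, hxZ₄, hX₄⟩ := exists_eq_sup_span h4 (hZ.trans X₄.2.2.symm)
  have hsup : X₁.1 ⊔ X₃.1 = X₁.1 ⊔ ℂ ∙ x₃ := by
    rw [hX₃, ← sup_assoc, sup_eq_left.2 (inf_le_left : X₁.1 ⊓ X₂.1 ≤ X₁.1)]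
  have o3 := mem_orthogonal_of_star_direction hx₃ hxZ₃ hX₃ inf_le_left h13
  have o4 := mem_orthogonal_of_star_direction hx₄ hxZ₄ hX₄ inf_le_left h14
  -- `X₄` is not contained in `X₁ + X₃`, as otherwise `x₄` would be proportional to `x₃`.
  have hnle : ¬ X₄.1 ≤ X₁.1 ⊔ X₃.1 := by
    intro hle
    have hm : x₄ ∈ X₁.1 ⊔ ℂ ∙ x₃ := by
      rw [← hsup]
      refine hle ?_
      rw [hX₄]
      exact Submodule.mem_sup_right (Submodule.mem_span_singleton_self _)
    rw [sup_comm] at hm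
    obtain ⟨w, hw, p, hp, hwp⟩ := Submodule.mem_sup.1 hm
    have hwo : w ∈ X₁.1ᗮ := (Submodule.span_singleton_le_iff_mem _ _).2 o3 hw
    have hpo : p ∈ X₁.1ᗮ := by
      rw [← hwp] at o4
      simpa using Submodule.sub_mem _ o4 hwo
    rw [inner_self_eq_zero.1 (hpo p hp), add_zero] at hwp
    refine hne.symm (Grassmannian.eq_of_le ?_)
    rw [hX₄, hX₃]
    refine sup_le_sup_left ((Submodule.span_singleton_le_iff_mem _ _).2 ?_) _
    rwa [← hwp]
  have hlt : X₁.1 ⊔ X₃.1 < X₁.1 ⊔ X₃.1 ⊔ X₄.1 :=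
    lt_of_le_of_ne le_sup_left fun h => hnle (le_sup_right.trans h.ge)
  have star : X₁.1 ⊓ X₂.1 ≤ N.1 → N = X₂ := by
    intro hZN
    obtain ⟨y, hy, hyZ, hN⟩ := exists_eq_sup_span hZN (hZ.trans N.2.2.symm)
    have hyV : y ∈ (X₁.1 ⊔ X₃.1 ⊔ X₄.1)ᗮ := by
      rw [← Submodule.inf_orthogonal, ← Submodule.inf_orthogonal]
      exact ⟨⟨mem_orthogonal_of_star_direction hy hyZ hN inf_le_left hN1.symm,
        mem_orthogonal_of_star_direction hy hyZ hN h3 hN3.symm⟩,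
        mem_orthogonal_of_star_direction hy hyZ hN h4 hN4.symm⟩
    have hxV : x₂ ∈ (X₁.1 ⊔ X₃.1 ⊔ X₄.1)ᗮ := by
      rw [← Submodule.inf_orthogonal, ← Submodule.inf_orthogonal]
      exact ⟨⟨mem_orthogonal_of_star_direction hx₂ hxZ₂ hX₂ inf_le_left h12,
        mem_orthogonal_of_star_direction hx₂ hxZ₂ hX₂ h3 h23.symm⟩,
        mem_orthogonal_of_star_direction hx₂ hxZ₂ hX₂ h4 h24.symm⟩
    have f1 := Submodule.finrank_lt_finrank_of_lt hlt
    have f2 := (X₁.1 ⊔ X₃.1 ⊔ X₄.1).finrank_add_finrank_orthogonal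
    have f3 := finrank_sup_of_adj h13
    have hspan : ℂ ∙ x₂ = (X₁.1 ⊔ X₃.1 ⊔ X₄.1)ᗮ := by
      refine Submodule.eq_of_le_of_finrank_le
        ((Submodule.span_singleton_le_iff_mem _ _).2 hxV) ?_
      rw [finrank_span_singleton hx₂]
      omega
    refine Grassmannian.eq_of_le (hN.le.trans (le_trans ?_ hX₂.ge))
    rw [hspan]
    exact sup_le_sup_left ((Submodule.span_singleton_le_iff_mem _ _).2 hyV) _
  by_cases s3 : IsStar X₁ X₃ N
  · rw [IsStar, ← e13] at s3
    exact star s3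
  by_cases s4 : IsStar X₁ X₄ N
  · rw [IsStar, ← e14] at s4
    exact star s4
  have l3 := le_sup_of_not_isStar h13 hN1.symm hN3.symm s3
  have l4 := le_sup_of_not_isStar h14 hN1.symm hN4.symm s4
  have hinf : finrank ℂ ((X₁.1 ⊔ X₃.1) ⊓ (X₁.1 ⊔ X₄.1) : Submodule ℂ H) <
      finrank ℂ (X₁.1 ⊔ X₄.1 : Submodule ℂ H) :=
    Submodule.finrank_lt_finrank_of_lt (lt_of_le_of_ne inf_le_right fun h =>
      hnle (le_sup_right.trans (h.ge.trans inf_le_left)))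
  rw [finrank_sup_of_adj h14] at hinf
  have hX1 : X₁.1 = (X₁.1 ⊔ X₃.1) ⊓ (X₁.1 ⊔ X₄.1) := by
    refine Submodule.eq_of_le_of_finrank_le (le_inf le_sup_left le_sup_left) ?_
    rw [X₁.2.2]
    omega
  exact absurd (Grassmannian.eq_of_le ((le_inf l3 l4).trans hX1.ge)) hN1.ne

/-- Star triangles on a common edge have images of the same type. In dimension greater than `k + 3`
a further direction orthogonal to all of them completes each to a clique of four vertices; in
dimension `k + 3` the uniqueness in `eq_of_adj_of_isStar` excludes images of different types. -/
theorem isStar_map_of_isStar [FiniteDimensional ℂ H] (hk : k + 3 ≤ finrank ℂ H)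
    (f : orthoGrassmannGraph H k ≃g orthoGrassmannGraph H k)
    (h12 : (orthoGrassmannGraph H k).Adj X₁ X₂) (h13 : (orthoGrassmannGraph H k).Adj X₁ X₃)
    (h23 : (orthoGrassmannGraph H k).Adj X₂ X₃) (h14 : (orthoGrassmannGraph H k).Adj X₁ X₄)
    (h24 : (orthoGrassmannGraph H k).Adj X₂ X₄) (h3 : IsStar X₁ X₂ X₃) (h4 : IsStar X₁ X₂ X₄)
    (hf : IsStar (f X₁) (f X₂) (f X₃)) : IsStar (f X₁) (f X₂) (f X₄) := by
  rcases hk.eq_or_lt with hk | hk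
  · by_contra hf4
    obtain ⟨Q, hQ2, hQ1, hQ3, hQ4⟩ := exists_second_neighbor (f.map_adj_iff.2 h12)
      (f.map_adj_iff.2 h13) (f.map_adj_iff.2 h23) (f.map_adj_iff.2 h14) (f.map_adj_iff.2 h24) hf hf4
    obtain ⟨N, rfl⟩ := f.surjective Q
    rw [f.map_adj_iff] at hQ1 hQ3 hQ4
    refine hQ2 (congrArg f (eq_of_adj_of_isStar hk.ge h12 h13 h23 h14 h24 h3 h4 ?_ hQ1 hQ3 hQ4))
    rintro rfl
    exact hf4 hf
  · have hZ := finrank_inf_of_adj h12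
    have hZ123 : X₁.1 ⊓ X₂.1 ≤ X₁.1 ⊔ X₂.1 ⊔ X₃.1 :=
      inf_le_left.trans (le_sup_left.trans le_sup_left)
    have d1 := finrank_sup_le_of_le hZ hZ123 h4
    have d2 := finrank_sup_sup_le h12 h13
    obtain ⟨N, hN, h⟩ := exists_adj_of_lt (V := X₁.1 ⊔ X₂.1 ⊔ X₃.1 ⊔ X₄.1) hZ
      (hZ123.trans le_sup_left) (by
        rw [← finrank_eq_rank]
        exact_mod_cast (by omega))
    have a1 := f.map_adj_iff.2 (h _ inf_le_left ((le_sup_left.trans le_sup_left).trans le_sup_left))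
    have a2 := f.map_adj_iff.2
      (h _ inf_le_right ((le_sup_right.trans le_sup_left).trans le_sup_left))
    have a3 := f.map_adj_iff.2 (h _ h3 (le_sup_right.trans le_sup_left))
    have a4 := f.map_adj_iff.2 (h _ h4 le_sup_right)
    rw [← f.map_adj_iff] at h12 h13 h23 h14 h24
    exact (hf.of_clique h12 h13 h23 a1.symm a2.symm a3.symm).of_clique h12 a1.symm a2.symm h14
      h24 a4

end

/-! ### The middle dimension -/

section

variable {H : Type*} [NormedAddCommGroup H] [InnerProductSpace ℂ H] [CompleteSpace H]
variable {k : ℕ} {X Y X₁ X₂ X₃ X₄ : Grassmannian H k}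

/-- Exchanging both parameters of a neighbour of `X` one at a time: `M` takes its intersection with
`X` from `X₁` and its sum with `X` from `X₂`. -/
theorem exists_adj_inf_sup (h1 : (orthoGrassmannGraph H k).Adj X X₁)
    (h2 : (orthoGrassmannGraph H k).Adj X X₂) :
    ∃ M, (orthoGrassmannGraph H k).Adj X M ∧ X.1 ⊓ M.1 = X.1 ⊓ X₁.1 ∧
      X.1 ⊔ M.1 = X.1 ⊔ X₂.1 := by
  have hZ := finrank_inf_of_adj h1
  obtain ⟨x, hx, hxZ, hX⟩ := exists_eq_sup_span (inf_le_left : X.1 ⊓ X₁.1 ≤ X.1)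
    (hZ.trans X.2.2.symm)
  obtain ⟨y, hy, hyX, hsup⟩ := exists_eq_sup_span (le_sup_left : X.1 ≤ X.1 ⊔ X₂.1)
    ((congrArg (· + 1) X.2.2).trans (finrank_sup_of_adj h2).symm)
  have hyZ : y ∈ (X.1 ⊓ X₁.1)ᗮ := Submodule.orthogonal_le inf_le_left hyX
  obtain ⟨M, hM⟩ := exists_grassmannian_eq_sup_span hZ hy hyZ
  have hxy : inner ℂ x y = 0 := hyX x (by
    rw [hX]
    exact Submodule.mem_sup_right (Submodule.mem_span_singleton_self x))
  refine ⟨M, (adj_iff_inner_eq_zero hx hy hxZ hyZ hX hM).2 hxy, ?_, ?_⟩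
  · have := sup_span_inf_sup_span hxZ hyZ hxy
    rwa [← hX, ← hM] at this
  · rw [hM, ← sup_assoc, sup_eq_left.2 (inf_le_left : X.1 ⊓ X₁.1 ≤ X.1), hsup]

variable [FiniteDimensional ℂ H]

/-- The orthocomplementary map interchanges the two types of triangles. -/
theorem isStar_orthocomplementIso_iff (h : k + k = finrank ℂ H)
    (h12 : (orthoGrassmannGraph H k).Adj X₁ X₂) (h13 : (orthoGrassmannGraph H k).Adj X₁ X₃)
    (h23 : (orthoGrassmannGraph H k).Adj X₂ X₃) :
    IsStar (orthocomplementIso h X₁) (orthocomplementIso h X₂) (orthocomplementIso h X₃) ↔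
      ¬ IsStar X₁ X₂ X₃ := by
  rw [IsStar, orthocomplementIso_apply, orthocomplementIso_apply, orthocomplementIso_apply,
    Submodule.inf_orthogonal, Submodule.orthogonal_le_orthogonal_iff]
  exact ⟨fun hle hs => hs.not_le_sup h12 h13 h23 hle, le_sup_of_not_isStar h12 h13 h23⟩

/-- The dual of `isStar_map_of_isStar`, obtained by composing `f` with the orthocomplementary
map. -/
theorem isStar_map_of_not_isStar (h : k + k = finrank ℂ H) (hk : 3 ≤ k)
    (f : orthoGrassmannGraph H k ≃g orthoGrassmannGraph H k)
    (h12 : (orthoGrassmannGraph H k).Adj X₁ X₂) (h13 : (orthoGrassmannGraph H k).Adj X₁ X₃)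
    (h23 : (orthoGrassmannGraph H k).Adj X₂ X₃) (h14 : (orthoGrassmannGraph H k).Adj X₁ X₄)
    (h24 : (orthoGrassmannGraph H k).Adj X₂ X₄) (h3 : ¬ IsStar X₁ X₂ X₃) (h4 : ¬ IsStar X₁ X₂ X₄)
    (hf : IsStar (f X₁) (f X₂) (f X₃)) : IsStar (f X₁) (f X₂) (f X₄) := by
  let c := orthocomplementIso h
  have key : ∀ X, (c.symm.trans f) (c X) = f X := fun X =>
    congrArg f (RelIso.symm_apply_apply c X)
  have := isStar_map_of_isStar (by omega) (c.symm.trans f) (c.map_adj_iff.2 h12)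
    (c.map_adj_iff.2 h13) (c.map_adj_iff.2 h23) (c.map_adj_iff.2 h14) (c.map_adj_iff.2 h24)
    ((isStar_orthocomplementIso_iff h h12 h13 h23).2 h3)
    ((isStar_orthocomplementIso_iff h h12 h14 h24).2 h4)
  simp only [key] at this
  exact this hf

theorem exists_isStar (hk : k + 3 ≤ finrank ℂ H) (h12 : (orthoGrassmannGraph H k).Adj X₁ X₂) :
    ∃ N, (orthoGrassmannGraph H k).Adj X₁ N ∧ (orthoGrassmannGraph H k).Adj X₂ N ∧
      IsStar X₁ X₂ N := by
  obtain ⟨N, hN, h1, h2, -⟩ := exists_adj_three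
    (by rw [← finrank_eq_rank]; exact_mod_cast hk) (finrank_inf_of_adj h12)
    (inf_le_left : _ ≤ X₁.1) (inf_le_right : _ ≤ X₂.1) (inf_le_right : _ ≤ X₂.1)
  exact ⟨N, h1.symm, h2.symm, hN⟩

theorem exists_not_isStar (h : k + k = finrank ℂ H) (hk : 3 ≤ k)
    (h12 : (orthoGrassmannGraph H k).Adj X₁ X₂) :
    ∃ N, (orthoGrassmannGraph H k).Adj X₁ N ∧ (orthoGrassmannGraph H k).Adj X₂ N ∧
      ¬ IsStar X₁ X₂ N := by
  obtain ⟨N, h1, h2, hN⟩ := exists_isStar (by omega) ((orthocomplementIso h).map_adj_iff.2 h12)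
  obtain ⟨N, rfl⟩ := (orthocomplementIso h).surjective N
  rw [(orthocomplementIso h).map_adj_iff] at h1 h2
  exact ⟨N, h1, h2, (isStar_orthocomplementIso_iff h h12 h1 h2).1 hN⟩

/-- Whether `f` preserves the type of a triangle depends only on one of its edges. The star and the
other completions of an edge cannot all have images of one type, since `f` is onto. -/
theorem isStar_map_iff_of_edge (h : k + k = finrank ℂ H) (hk : 3 ≤ k)
    (f : orthoGrassmannGraph H k ≃g orthoGrassmannGraph H k)
    (h12 : (orthoGrassmannGraph H k).Adj X₁ X₂) (h13 : (orthoGrassmannGraph H k).Adj X₁ X₃)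
    (h23 : (orthoGrassmannGraph H k).Adj X₂ X₃) (h14 : (orthoGrassmannGraph H k).Adj X₁ X₄)
    (h24 : (orthoGrassmannGraph H k).Adj X₂ X₄)
    (hf : IsStar (f X₁) (f X₂) (f X₃) ↔ IsStar X₁ X₂ X₃) :
    IsStar (f X₁) (f X₂) (f X₄) ↔ IsStar X₁ X₂ X₄ := by
  have hsame : ∀ {A B : Grassmannian H k}, (orthoGrassmannGraph H k).Adj X₁ A →
      (orthoGrassmannGraph H k).Adj X₂ A → (orthoGrassmannGraph H k).Adj X₁ B →
      (orthoGrassmannGraph H k).Adj X₂ B → (IsStar X₁ X₂ A ↔ IsStar X₁ X₂ B) →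
      (IsStar (f X₁) (f X₂) (f A) ↔ IsStar (f X₁) (f X₂) (f B)) := by
    intro A B h1A h2A h1B h2B hAB
    by_cases hA : IsStar X₁ X₂ A
    · exact ⟨isStar_map_of_isStar (by omega) f h12 h1A h2A h1B h2B hA (hAB.1 hA),
        isStar_map_of_isStar (by omega) f h12 h1B h2B h1A h2A (hAB.1 hA) hA⟩
    · have hB := fun hB => hA (hAB.2 hB)
      exact ⟨isStar_map_of_not_isStar h hk f h12 h1A h2A h1B h2B hA hB,
        isStar_map_of_not_isStar h hk f h12 h1B h2B h1A h2A hB hA⟩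
  by_cases hAB : IsStar X₁ X₂ X₃ ↔ IsStar X₁ X₂ X₄
  · rw [← hsame h13 h23 h14 h24 hAB, hf, hAB]
  · -- Every completion of the edge has the same type as `X₃` or as `X₄`.
    have hall : ∀ N, (orthoGrassmannGraph H k).Adj X₁ N → (orthoGrassmannGraph H k).Adj X₂ N →
        (IsStar (f X₁) (f X₂) (f N) ↔ IsStar (f X₁) (f X₂) (f X₃)) ∨
        (IsStar (f X₁) (f X₂) (f N) ↔ IsStar (f X₁) (f X₂) (f X₄)) := by
      intro N h1 h2
      by_cases hN : IsStar X₁ X₂ N ↔ IsStar X₁ X₂ X₃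
      · exact Or.inl (hsame h1 h2 h13 h23 hN)
      · exact Or.inr (hsame h1 h2 h14 h24 (by tauto))
    obtain ⟨M, hM1, hM2, hM⟩ := exists_isStar (by omega) (f.map_adj_iff.2 h12)
    obtain ⟨M', hM1', hM2', hM'⟩ := exists_not_isStar h hk (f.map_adj_iff.2 h12)
    obtain ⟨M, rfl⟩ := f.surjective M
    obtain ⟨M', rfl⟩ := f.surjective M'
    rw [f.map_adj_iff] at hM1 hM2 hM1' hM2'
    have e1 := hall M hM1 hM2
    have e2 := hall M' hM1' hM2'
    tauto

/-- Two neighbours of `X` with the same intersection with `X` have a common neighbour in the link of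
`X`. -/
theorem exists_adj_of_inf_eq (hk : k + 3 ≤ finrank ℂ H) (h1 : (orthoGrassmannGraph H k).Adj X X₁)
    (h : X.1 ⊓ X₁.1 = X.1 ⊓ X₂.1) :
    ∃ N, (orthoGrassmannGraph H k).Adj X N ∧ (orthoGrassmannGraph H k).Adj X₁ N ∧
      (orthoGrassmannGraph H k).Adj X₂ N := by
  obtain ⟨N, hN, h1, h2, h3⟩ := exists_adj_three
    (by rw [← finrank_eq_rank]; exact_mod_cast hk) (finrank_inf_of_adj h1)
    (inf_le_left : _ ≤ X.1) (inf_le_right : _ ≤ X₁.1) (h.le.trans inf_le_right : _ ≤ X₂.1)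
  exact ⟨N, h1.symm, h2.symm, h3.symm⟩

/-- The dual of `exists_adj_of_inf_eq`. -/
theorem exists_adj_of_sup_eq (h : k + k = finrank ℂ H) (hk : 3 ≤ k)
    (h1 : (orthoGrassmannGraph H k).Adj X X₁)
    (he : X.1 ⊔ X₁.1 = X.1 ⊔ X₂.1) :
    ∃ N, (orthoGrassmannGraph H k).Adj X N ∧ (orthoGrassmannGraph H k).Adj X₁ N ∧
      (orthoGrassmannGraph H k).Adj X₂ N := by
  let c := orthocomplementIso h
  obtain ⟨N, hN, hN1, hN2⟩ := exists_adj_of_inf_eq (X₂ := c X₂) (by omega) (c.map_adj_iff.2 h1)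
    (by
      change X.1ᗮ ⊓ X₁.1ᗮ = X.1ᗮ ⊓ X₂.1ᗮ
      rw [Submodule.inf_orthogonal, Submodule.inf_orthogonal, he])
  obtain ⟨N, rfl⟩ := c.surjective N
  exact ⟨N, c.map_adj_iff.1 hN, c.map_adj_iff.1 hN1, c.map_adj_iff.1 hN2⟩

/-- If `f` preserves the type of one triangle, it preserves the types of all. -/
theorem isStar_map_iff_of_triangle (h : k + k = finrank ℂ H) (hk : 3 ≤ k)
    (f : orthoGrassmannGraph H k ≃g orthoGrassmannGraph H k)
    (h12 : (orthoGrassmannGraph H k).Adj X₁ X₂) (h13 : (orthoGrassmannGraph H k).Adj X₁ X₃)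
    (h23 : (orthoGrassmannGraph H k).Adj X₂ X₃)
    (hf : IsStar (f X₁) (f X₂) (f X₃) ↔ IsStar X₁ X₂ X₃) {Y₁ Y₂ Y₃ : Grassmannian H k}
    (k12 : (orthoGrassmannGraph H k).Adj Y₁ Y₂) (k13 : (orthoGrassmannGraph H k).Adj Y₁ Y₃)
    (k23 : (orthoGrassmannGraph H k).Adj Y₂ Y₃) :
    IsStar (f Y₁) (f Y₂) (f Y₃) ↔ IsStar Y₁ Y₂ Y₃ := by
  let T : Grassmannian H k → Grassmannian H k → Prop := fun X Y =>
    ∀ N, (orthoGrassmannGraph H k).Adj X N → (orthoGrassmannGraph H k).Adj Y N →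
      (IsStar (f X) (f Y) (f N) ↔ IsStar X Y N)
  have hsymm : ∀ {X Y}, T X Y → T Y X := fun hT N h1 h2 => by
    rw [isStar_swap_left (X₃ := f N), isStar_swap_left (X₃ := N)]
    exact hT N h2 h1
  have hstep : ∀ {X Y N}, (orthoGrassmannGraph H k).Adj X Y → (orthoGrassmannGraph H k).Adj X N →
      (orthoGrassmannGraph H k).Adj Y N → T X Y → T X N := by
    intro X Y N hXY hXN hYN hT M hXM hNM
    refine isStar_map_iff_of_edge h hk f hXN hXY hYN.symm hXM hNM ?_
    rw [← isStar_swap_right hXY hXN,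
      ← isStar_swap_right (f.map_adj_iff.2 hXY) (f.map_adj_iff.2 hXN)]
    exact hT N hXN hYN
  have hlink : ∀ {X Y Y'}, (orthoGrassmannGraph H k).Adj X Y →
      (orthoGrassmannGraph H k).Adj X Y' → T X Y → T X Y' := by
    intro X Y Y' hY hY' hT
    obtain ⟨M, hM, hinf, hsup⟩ := exists_adj_inf_sup hY hY'
    obtain ⟨N, hN, hN1, hN2⟩ := exists_adj_of_inf_eq (by omega) hY hinf.symm
    obtain ⟨N', hN', hN1', hN2'⟩ := exists_adj_of_sup_eq h hk hM hsup
    exact hstep hN' hY' hN2'.symm <| hstep hM hN' hN1' <| hstep hN hM hN2.symm <|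
      hstep hY hN hN1 hT
  refine forall_of_adj_closed (by rw [← finrank_eq_rank]; exact_mod_cast (by omega))
    (fun X => ∀ Y, (orthoGrassmannGraph H k).Adj X Y → T X Y) ?_ (X := X₁) ?_ Y₁ Y₂ k12 Y₃ k13 k23
  · exact fun {X Y} hXY hX Z hYZ => hlink hXY.symm hYZ (hsymm (hX Y hXY))
  · refine fun Y hY => hlink h12 hY fun N hN1 hN2 => ?_
    exact isStar_map_iff_of_edge h hk f h12 h13 h23 hN1 hN2 hf

theorem isInduced_of_isStar_map_iff (h : k + k = finrank ℂ H) (hk : 3 ≤ k)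
    (f : orthoGrassmannGraph H k ≃g orthoGrassmannGraph H k)
    (hf : ∀ {X₁ X₂ X₃}, (orthoGrassmannGraph H k).Adj X₁ X₂ →
      (orthoGrassmannGraph H k).Adj X₁ X₃ → (orthoGrassmannGraph H k).Adj X₂ X₃ →
      (IsStar (f X₁) (f X₂) (f X₃) ↔ IsStar X₁ X₂ X₃)) :
    IsInducedByUnitaryOrAntiunitary f := by
  obtain ⟨k, rfl⟩ : ∃ l, k = l + 1 := ⟨k - 1, by omega⟩
  obtain ⟨g, hg⟩ := exists_descent
    (by rw [← finrank_eq_rank]; exact_mod_cast (by omega)) f hf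
  exact isInduced_of_descent (by omega) hg (isInduced_of_two_mul_lt (by omega)
    (by rw [← finrank_eq_rank]; exact_mod_cast (by omega)) g)

theorem isInduced_or_of_middle (h : k + k = finrank ℂ H) (hk : 3 ≤ k)
    (f : orthoGrassmannGraph H k ≃g orthoGrassmannGraph H k) :
    IsInducedByUnitaryOrAntiunitary f ∨
      ∃ g : orthoGrassmannGraph H k ≃g orthoGrassmannGraph H k,
        IsInducedByUnitaryOrAntiunitary g ∧ ∀ X, (f X).1 = ((g X).1)ᗮ := by
  by_cases hex : ∃ X₁ X₂ X₃ : Grassmannian H k, (orthoGrassmannGraph H k).Adj X₁ X₂ ∧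
      (orthoGrassmannGraph H k).Adj X₁ X₃ ∧ (orthoGrassmannGraph H k).Adj X₂ X₃ ∧
      (IsStar (f X₁) (f X₂) (f X₃) ↔ IsStar X₁ X₂ X₃)
  · obtain ⟨X₁, X₂, X₃, h12, h13, h23, hf⟩ := hex
    exact Or.inl (isInduced_of_isStar_map_iff h hk f fun k12 k13 k23 =>
      isStar_map_iff_of_triangle h hk f h12 h13 h23 hf k12 k13 k23)
  · refine Or.inr ⟨f.trans (orthocomplementIso h), isInduced_of_isStar_map_iff h hk _
      fun {X₁ X₂ X₃} h12 h13 h23 => ?_, fun X => ((f X).1.orthogonal_orthogonal).symm⟩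
    refine (isStar_orthocomplementIso_iff h (f.map_adj_iff.2 h12) (f.map_adj_iff.2 h13)
      (f.map_adj_iff.2 h23)).trans ?_
    have : ¬ (IsStar (f X₁) (f X₂) (f X₃) ↔ IsStar X₁ X₂ X₃) := fun hf =>
      hex ⟨X₁, X₂, X₃, h12, h13, h23, hf⟩
    tauto

end

end OrthoGrassmann

theorem theorem2 {H : Type*} [NormedAddCommGroup H] [InnerProductSpace ℂ H] [CompleteSpace H]
    (k : ℕ) (hk : 0 < k) (hkH : (k : Cardinal) < Module.rank ℂ H) :
    (Module.rank ℂ H ≠ ((2 * k : ℕ) : Cardinal) →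
      ∀ f : OrthoGrassmann.orthoGrassmannGraph H k ≃g OrthoGrassmann.orthoGrassmannGraph H k,
        OrthoGrassmann.IsInducedByUnitaryOrAntiunitary f) ∧
    (Module.rank ℂ H = ((2 * k : ℕ) : Cardinal) → 6 ≤ 2 * k →
      ∀ f : OrthoGrassmann.orthoGrassmannGraph H k ≃g OrthoGrassmann.orthoGrassmannGraph H k,
        OrthoGrassmann.IsInducedByUnitaryOrAntiunitary f ∨
        ∃ g : OrthoGrassmann.orthoGrassmannGraph H k ≃g OrthoGrassmann.orthoGrassmannGraph H k,
          OrthoGrassmann.IsInducedByUnitaryOrAntiunitary g ∧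
          ∀ X, (f X).1 = ((g X).1)ᗮ) := by
  refine ⟨fun hne f => ?_, fun he h6 f => ?_⟩
  · rcases lt_or_gt_of_ne hne with hlt | hgt
    · -- Here `H` has finite dimension `k + l` with `l < k`, and the complementary dimension `l`
      -- lies below the middle.
      have hfin : FiniteDimensional ℂ H := Module.rank_lt_aleph0_iff.1
        (hlt.trans (Cardinal.natCast_lt_aleph0))
      rw [← Module.finrank_eq_rank] at hlt hkH
      have h1 : k < Module.finrank ℂ H := by exact_mod_cast hkH
      have h2 : Module.finrank ℂ H < 2 * k := by exact_mod_cast hlt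
      have h3 : k + (Module.finrank ℂ H - k) = Module.finrank ℂ H := by omega
      refine OrthoGrassmann.isInduced_of_conj h3 f ?_
      refine OrthoGrassmann.isInduced_of_two_mul_lt (by omega) ?_
        (((OrthoGrassmann.orthocomplementIso h3).symm.trans f).trans
          (OrthoGrassmann.orthocomplementIso h3))
      rw [← Module.finrank_eq_rank]
      exact_mod_cast (by omega)
    · refine OrthoGrassmann.isInduced_of_two_mul_lt hk ?_ f
      rw [Nat.cast_succ]
      exact Cardinal.natCast_add_one_le_iff.2 hgt
  · have hfin : FiniteDimensional ℂ H := Module.rank_lt_aleph0_iff.1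
      (he.trans_lt Cardinal.natCast_lt_aleph0)
    rw [← Module.finrank_eq_rank] at he
    have h1 : Module.finrank ℂ H = 2 * k := by exact_mod_cast he
    exact OrthoGrassmann.isInduced_or_of_middle (by omega) (by omega) f
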